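/- For an integer $N\ge 1$, a real number $p>0$ and unit vectors $x_1,\dots,x_N\in\mathbb{R}^2$, let $\mathrm{FP}_{p}(x_1,\dots,x_N)=\sum_{k=1}^N\sum_{\ell\ne k}|\langle x_k,x_\ell\rangle|^p$ be the $p$-frame potential. Let $0<p\le \frac{\log 3}{\log 2}$ and let $N\ge 3$ be odd. Then the minimum of $\mathrm{FP}_{p}$ over all $N$-tuples of unit vectors in $\mathbb{R}^2$ is $(N-1)^2/2$. It is attained at the configuration $X_N^\perp$ consisting of $(N+1)/2$ copies of $e_1=(1,0)$ and $(N-1)/2$ copies of $e_2=(0,1)$, and at every configuration equivalent to $X_N^\perp$; here $(x_k)_k$ and $(x'_k)_k$ are equivalent if $x'_k=s_kUx_{\pi(k)}$ for all $k$, with an orthogonal matrix $U$, a permutation $\pi$ of $\{1,\dots,N\}$ and signs $s_k\in\{-1,1\}$. Moreover, except when $N=3$ and $p=\frac{\log 3}{\log 2}$, the minimizer is unique up to this equivalence: every minimizer is equivalent to $X_N^\perp$. -/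

import Mathlib

/-- Ordered multisets of `N` unit vectors in `ℝ^d`. -/
abbrev UnitConfig (N d : ℕ) : Type :=
  Fin N → Metric.sphere (0 : EuclideanSpace ℝ (Fin d)) 1

/-- The `p`-frame potential (for a finite exponent `p`) of a configuration `X`:
the sum of `|⟨x_k, x_ℓ⟩|^p` over all ordered pairs of distinct indices. -/
noncomputable def framePotential {N d : ℕ} (p : ℝ) (X : UnitConfig N d) : ℝ :=
  ∑ k : Fin N, ∑ l ∈ Finset.univ.erase k,
    |inner ℝ (X k : EuclideanSpace ℝ (Fin d)) (X l : EuclideanSpace ℝ (Fin d))| ^ p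

/-- `X` is a global minimizer of the `p`-frame potential among all configurations of `N` unit
vectors in `ℝ^d`. -/
def IsFrameMinimizer {N d : ℕ} (p : ℝ) (X : UnitConfig N d) : Prop :=
  ∀ Y : UnitConfig N d, framePotential p X ≤ framePotential p Y

/-- `X'` arises from `X` by an orthogonal transformation, a permutation of the indices and
sign changes of the individual vectors. -/
def ConfigEquiv {N d : ℕ} (X X' : UnitConfig N d) : Prop :=
  ∃ (U : EuclideanSpace ℝ (Fin d) ≃ₗᵢ[ℝ] EuclideanSpace ℝ (Fin d))
    (σ : Equiv.Perm (Fin N)) (s : Fin N → ℝ),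
    (∀ k, s k = 1 ∨ s k = -1) ∧
    ∀ k, (X' k : EuclideanSpace ℝ (Fin d)) = s k • U (X (σ k) : EuclideanSpace ℝ (Fin d))

/-- The `i`-th standard basis vector of `ℝ^d`, as a point of the unit sphere. -/
noncomputable def stdVec {d : ℕ} (i : Fin d) : Metric.sphere (0 : EuclideanSpace ℝ (Fin d)) 1 :=
  ⟨EuclideanSpace.single i 1, by simp⟩

/-- The configuration in `ℝ^2` consisting of `⌈N/2⌉` copies of `e₁` followed by `⌊N/2⌋` copies
of `e₂`; for odd `N` these numbers are `(N+1)/2` and `(N-1)/2`. -/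
noncomputable def perpConfig (N : ℕ) : UnitConfig N 2 :=
  fun k => if (k : ℕ) < (N + 1) / 2 then stdVec 0 else stdVec 1

/-!
Only the critical exponent `p = log 3 / log 2` matters for the lower bound: inner products of unit
vectors have absolute value at most `1`, so the potential decreases in `p`, strictly unless all
inner products are `0` or `±1`. With the diagonal included, the claim at the critical exponent is
that the sum over all ordered pairs of `w ^ halfExp` is at least `(N² + 1) / 2`, where `w` is the
squared inner product of the pair.

The proof adds two lines at a time (`potential_ge_and_eq`). In a configuration of `N = n + 2`
lines, take a pair `k, l` closest to orthogonal, with squared inner product `x`, and compare with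
the `n` remaining lines.

* If `x = 0`, a third line has squared inner products `u` and `1 - u` with the pair, and
  `u ^ halfExp + (1 - u) ^ halfExp ≥ 1`, with equality only for `u ∈ {0, 1}`. This also gives the
  equality case.
* If `x > 0` and `N = 3`, the claim is trivial or amounts to
  `sin s ^ p + sin t ^ p + cos (s + t) ^ p ≥ 1` for nonnegative angles with `s + t ≤ π / 2`
  (`one_le_three_angles`). Equality at `s = t = π / 6` is what makes the exponent critical.
* If `x > 0` and `N ≥ 5`, the inequality is strict (`lt_potential_insert_of_isMin`). Write
  `w ^ halfExp = w + gain w` with `gain` concave, nonnegative on `[0, 1]` and zero at its ends. The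
  sum of the `w` is `(N² + |Z|²) / 2`, where `Z` is the sum of the unit vectors with doubled angles.
  When `√x ≥ 1 / 4`, a chord bound for `gain` over all pairs suffices. When
  `1 / (3 n) ≤ √x ≤ 1 / 4`, each remaining line contributes a definite amount of `gain`, up to a
  term linear in its deviation `u + v - 1`, and the sum of the deviations is at least `-√x |Z'|`,
  with `Z'` the vector `Z` of the remaining lines. When `√x ≤ 1 / (3 n)`, each remaining line
  contributes at least `1 - x ^ halfExp / n`, and the missing terms are made up by the pair itself.

A minimizer whose inner products are all `0` or `±1` splits into two orthogonal directions, and the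
value of the potential fixes their multiplicities (`configEquiv_perpConfig_of_sqInner`).
-/

/-! ### The critical exponent and the concave gain -/

/-- Half of the critical exponent `log 3 / log 2`, so that `|t| ^ (log 3 / log 2)` becomes
`(t ^ 2) ^ halfExp`. -/
noncomputable def halfExp : ℝ := Real.log 3 / Real.log 4

/-- The excess `u ^ halfExp - u` of the critical potential over the exponent-two potential, as a
function of the squared inner product `u`. -/
noncomputable def gain (u : ℝ) : ℝ := u ^ halfExp - u

theorem four_rpow_halfExp : (4 : ℝ) ^ halfExp = 3 := by
  rw [halfExp, Real.rpow_def_of_pos (by norm_num), mul_div_cancel₀, Real.exp_log (by norm_num)]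
  exact (Real.log_pos (by norm_num)).ne'

/-- Here `84 / 53`, like `65 / 41` in `halfExp_lt`, is a convergent of the continued fraction of
`log 3 / log 2`. -/
theorem halfExp_gt : (42 / 53 : ℝ) < halfExp := by
  rw [halfExp, lt_div_iff₀ (Real.log_pos (by norm_num))]
  have h : Real.log ((4 : ℝ) ^ 42) < Real.log ((3 : ℝ) ^ 53) :=
    Real.log_lt_log (by norm_num) (by norm_num)
  rw [Real.log_pow, Real.log_pow] at h
  push_cast at h
  linarith

theorem halfExp_lt : halfExp < (65 / 82 : ℝ) := by
  rw [halfExp, div_lt_iff₀ (Real.log_pos (by norm_num))]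
  have h : Real.log ((3 : ℝ) ^ 82) < Real.log ((4 : ℝ) ^ 65) :=
    Real.log_lt_log (by norm_num) (by norm_num)
  rw [Real.log_pow, Real.log_pow] at h
  push_cast at h
  linarith

theorem halfExp_pos : 0 < halfExp := by linarith [halfExp_gt]

theorem halfExp_lt_one : halfExp < 1 := by linarith [halfExp_lt]

theorem log_three_eq : Real.log 3 = 2 * halfExp * Real.log 2 := by
  have h4 : Real.log 4 = 2 * Real.log 2 := by
    rw [show (4 : ℝ) = 2 ^ 2 by norm_num, Real.log_pow]; norm_num
  have : Real.log 2 ≠ 0 := (Real.log_pos (by norm_num)).ne'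
  rw [halfExp, h4]
  field_simp

theorem quarter_rpow (k : ℕ) : ((1 / 4 : ℝ) ^ k) ^ halfExp = (1 / 3) ^ k := by
  rw [← Real.rpow_natCast, ← Real.rpow_mul (by norm_num), mul_comm, Real.rpow_mul (by norm_num),
    Real.rpow_natCast, Real.div_rpow (by norm_num) (by norm_num), four_rpow_halfExp, Real.one_rpow]

theorem half_rpow_sq : ((1 / 2 : ℝ) ^ halfExp) ^ 2 = 1 / 3 := by
  have h := quarter_rpow 1
  rw [← Real.rpow_natCast, ← Real.rpow_mul (by norm_num), mul_comm, Real.rpow_mul (by norm_num)]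
  rw [pow_one, pow_one] at h
  rw [← h]; norm_num

theorem half_rpow_gt : (0.577 : ℝ) < (1 / 2 : ℝ) ^ halfExp := by
  have h : 0 < (1 / 2 : ℝ) ^ halfExp := Real.rpow_pos_of_pos (by norm_num) _
  nlinarith [half_rpow_sq]

theorem gain_concaveOn : ConcaveOn ℝ (Set.Ici 0) gain :=
  (Real.concaveOn_rpow halfExp_pos.le halfExp_lt_one.le).sub (convexOn_id (convex_Ici 0))

theorem gain_one : gain 1 = 0 := by simp [gain]

theorem gain_nonneg {u : ℝ} (h0 : 0 ≤ u) (h1 : u ≤ 1) : 0 ≤ gain u := by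
  rcases h0.eq_or_lt with rfl | h0
  · simp [gain, halfExp_pos.ne']
  · have := Real.rpow_le_rpow_of_exponent_ge h0 h1 halfExp_lt_one.le
    rw [Real.rpow_one] at this
    exact sub_nonneg.2 this

theorem gain_pos {u : ℝ} (h0 : 0 < u) (h1 : u < 1) : 0 < gain u := by
  have := Real.rpow_lt_rpow_of_exponent_gt h0 h1 halfExp_lt_one
  rw [Real.rpow_one] at this
  exact sub_pos.2 this

theorem min_gain_le {s t u : ℝ} (hs : 0 ≤ s) (h1 : s ≤ u) (h2 : u ≤ t) :
    min (gain s) (gain t) ≤ gain u :=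
  gain_concaveOn.min_le_of_mem_Icc hs (hs.trans (h1.trans h2)) ⟨h1, h2⟩

theorem gain_mul_le {s u : ℝ} (hs : 0 ≤ s) (h1 : s ≤ u) (h2 : u ≤ 1) :
    gain s * (1 - u) ≤ gain u * (1 - s) := by
  rcases h1.eq_or_lt with rfl | h1'
  · exact le_rfl
  have hs1 : 0 < 1 - s := by linarith
  have h := gain_concaveOn.2 hs (show (1 : ℝ) ∈ Set.Ici 0 by simp)
    (show 0 ≤ (1 - u) / (1 - s) from div_nonneg (by linarith) hs1.le)
    (show 0 ≤ (u - s) / (1 - s) from div_nonneg (by linarith) hs1.le) (by field_simp; ring)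
  have e : (1 - u) / (1 - s) * s + (u - s) / (1 - s) * 1 = u := by field_simp; ring
  simp only [smul_eq_mul, gain_one, mul_zero, add_zero, e] at h
  rw [div_mul_eq_mul_div, div_le_iff₀ hs1] at h
  linarith

/-- Chord bound: if `gain` lies above the line `τ (1 - ·)` at `s`, it does so up to `1`. -/
theorem le_gain_of_chord {τ s u : ℝ} (hs : 0 ≤ s) (hs1 : s < 1) (hτ : τ * (1 - s) ≤ gain s)
    (h1 : s ≤ u) (h2 : u ≤ 1) : τ * (1 - u) ≤ gain u := by
  have h := gain_mul_le hs h1 h2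
  have : τ * (1 - s) * (1 - u) ≤ gain u * (1 - s) :=
    (mul_le_mul_of_nonneg_right hτ (by linarith)).trans h
  nlinarith

/-- Adding the linear term `τ u` makes `gain` smallest at the left end of `[s, 1]`. -/
theorem gain_add_le {τ s u : ℝ} (hs : 0 ≤ s) (hs1 : s < 1) (hτ : gain s ≤ τ * (1 - s))
    (h1 : s ≤ u) (h2 : u ≤ 1) : gain s + τ * s ≤ gain u + τ * u := by
  have h := gain_mul_le hs h1 h2
  have : gain s * (u - s) ≤ τ * (1 - s) * (u - s) :=
    mul_le_mul_of_nonneg_right hτ (by linarith)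
  nlinarith

theorem gain_quarter_pow (k : ℕ) : gain ((1 / 4) ^ k) = (1 / 3) ^ k - (1 / 4) ^ k := by
  rw [gain, quarter_rpow]

theorem gain_quarter : gain (1 / 4) = 1 / 12 := by
  have := gain_quarter_pow 1; norm_num at this ⊢; exact this

theorem gain_half : 0.077 < gain (1 / 2) := by
  have := half_rpow_gt; rw [gain]; linarith

theorem gain_eighth : 0.067 < gain (1 / 8) := by
  have h : (1 / 8 : ℝ) ^ halfExp = 1 / 3 * (1 / 2) ^ halfExp := by
    have := quarter_rpow 1
    rw [pow_one, pow_one] at this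
    rw [← this, ← Real.mul_rpow (by norm_num) (by norm_num)]; norm_num
  rw [gain, h]; linarith [half_rpow_gt]

theorem gain_three_quarters : 0.045 < gain (3 / 4) := by
  have h : (2.385 : ℝ) < 3 ^ halfExp := by
    have h1 : (2.385 : ℝ) < 3 ^ (42 / 53 : ℝ) := by
      rw [show (42 / 53 : ℝ) = (42 : ℕ) * (53 : ℝ)⁻¹ by norm_num, Real.rpow_mul (by norm_num),
        Real.rpow_natCast, Real.lt_rpow_inv_iff_of_pos (by norm_num) (by norm_num) (by norm_num)]
      norm_num
    exact h1.trans (Real.rpow_lt_rpow_of_exponent_lt (by norm_num) halfExp_gt)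
  rw [gain, Real.div_rpow (by norm_num) (by norm_num), four_rpow_halfExp]
  linarith

theorem gain_lt_rpow_of_le {x y : ℝ} (h0 : 0 < x) (h : x ≤ y) : gain x < y ^ halfExp := by
  have := Real.rpow_le_rpow h0.le h halfExp_pos.le
  rw [gain]; linarith

/-- Lower bound for the excess of a third line over a nearly orthogonal pair with squared inner
product `x ≤ 1/64`, in terms of the squared inner products `u`, `v` with the two lines. The slope `0.18` is just below
that of the chord of `gain` over `[3 / 4, 1]`. -/
theorem gain_add_gain_ge_of_le_sixtyFourth {x u v : ℝ} (hx0 : 0 < x) (hx : x ≤ 1 / 64) (hxu : x ≤ u)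
    (hxv : x ≤ v) (hu : u ≤ 1) (hv : v ≤ 1) (huv : 1 - √x ≤ u + v) :
    gain x + 0.18 * (x - (u + v - 1)) ≤ gain u + gain v := by
  wlog h : u ≤ v generalizing u v
  · have := this hxv hxu hv hu (by linarith) (by linarith)
    linarith
  have hg : gain x < 1 / 27 := by
    have := gain_lt_rpow_of_le hx0 (y := (1 / 4) ^ 3) (by linarith)
    rw [quarter_rpow] at this; linarith
  have ha : √x ≤ 1 / 8 := Real.sqrt_le_iff.2 ⟨by norm_num, by linarith⟩
  rcases le_total (3 / 4) v with h3 | h3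
  · have h1 := le_gain_of_chord (τ := 0.18) (by norm_num) (by norm_num)
      (by linarith [gain_three_quarters]) h3 hv
    have h2 := gain_add_le (τ := 0.18) hx0.le (by linarith) (by linarith) hxu hu
    linarith
  · have m : (0.045 : ℝ) ≤ min (gain (1 / 8)) (gain (3 / 4)) :=
      le_min (by linarith [gain_eighth]) gain_three_quarters.le
    have h1 := min_gain_le (s := 1 / 8) (t := 3 / 4) (u := u) (by norm_num) (by linarith)
      (by linarith)
    have h2 := min_gain_le (s := 1 / 8) (t := 3 / 4) (u := v) (by norm_num) (by linarith)
      (by linarith)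
    linarith

/-- The same bound for a wider range of `x`, with a smaller slope: `0.15` is just below the chord
slope `2 * gain (1 / 2)`. -/
theorem gain_add_gain_ge_of_le_sixteenth {x u v : ℝ} (hx0 : 0 < x) (hx : x ≤ 1 / 16) (hxu : x ≤ u)
    (hxv : x ≤ v) (hu : u ≤ 1) (hv : v ≤ 1) (huv : 1 - √x ≤ u + v) :
    gain x + 0.15 * (x - (u + v - 1)) ≤ gain u + gain v := by
  wlog h : u ≤ v generalizing u v
  · have := this hxv hxu hv hu (by linarith) (by linarith)
    linarith
  have hg : gain x ≤ 7 / 144 := by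
    have h1 := min_gain_le hx0.le hx (t := 1 / 4) (by norm_num)
    have h2 := gain_quarter_pow 2
    norm_num at h2
    rw [h2, gain_quarter] at h1
    rcases min_le_iff.1 h1 with h | h
    · exact h
    · norm_num at h
  have ha : √x ≤ 1 / 4 := Real.sqrt_le_iff.2 ⟨by norm_num, by linarith⟩
  rcases le_total (1 / 2) v with h3 | h3
  · have h1 := le_gain_of_chord (τ := 0.15) (by norm_num) (by norm_num)
      (by linarith [gain_half]) h3 hv
    have h2 := gain_add_le (τ := 0.15) hx0.le (by linarith) (by linarith) hxu hu
    linarith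
  · have m : (0.077 : ℝ) ≤ min (gain (1 / 4)) (gain (1 / 2)) :=
      le_min (by linarith [gain_quarter]) gain_half.le
    have h1 := min_gain_le (s := 1 / 4) (t := 1 / 2) (u := u) (by norm_num) (by linarith)
      (by linarith)
    have h2 := min_gain_le (s := 1 / 4) (t := 1 / 2) (u := v) (by norm_num) (by linarith)
      (by linarith)
    linarith

theorem concaveOn_rpow_sub_one : ConcaveOn ℝ (Set.Ici 0) fun a : ℝ => a ^ (2 * halfExp - 1) :=
  Real.concaveOn_rpow (by linarith [halfExp_gt]) (by linarith [halfExp_lt])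

theorem sqrt_rpow {x : ℝ} (hx : 0 < x) : √x * √x ^ (2 * halfExp - 1) = x ^ halfExp := by
  have h := Real.sqrt_pos.2 hx
  rw [← Real.rpow_one_add' h.le (by linarith [halfExp_gt]), show 1 + (2 * halfExp - 1) = 2 * halfExp by ring,
    Real.rpow_mul h.le, Real.rpow_two, Real.sq_sqrt hx.le]

theorem half_pow_rpow (k : ℕ) : ((1 / 2 : ℝ) ^ k) ^ (2 * halfExp - 1) = (2 / 3) ^ k := by
  have h := sqrt_rpow (x := (1 / 4) ^ k) (by positivity)
  have e : √((1 / 4 : ℝ) ^ k) = (1 / 2) ^ k := by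
    rw [show ((1 / 4 : ℝ) ^ k) = ((1 / 2) ^ k) ^ 2 by rw [← pow_mul, mul_comm, pow_mul]; norm_num]
    exact Real.sqrt_sq (by positivity)
  rw [e, quarter_rpow] at h
  have : (2 / 3 : ℝ) ^ k = (1 / 3) ^ k / (1 / 2) ^ k := by rw [← div_pow]; norm_num
  rw [this, eq_div_iff (by positivity), mul_comm, h]

/-- The numerical inequality at `a = 1 / (3 n)`, where the two regimes of the induction step
meet. -/
theorem threshold_ineq {n : ℝ} (hn : 3 ≤ n) :
    0.82 * (4 / 3) < (n + 1) * (1 / (3 * n)) ^ (2 * halfExp - 1) := by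
  have h9 : (9 : ℝ) ^ (2 * halfExp - 1) < 3.63 := by
    have h1 : (9 : ℝ) ^ (24 / 41 : ℝ) < 3.63 := by
      rw [show (24 / 41 : ℝ) = (24 : ℕ) * (41 : ℝ)⁻¹ by norm_num, Real.rpow_mul (by norm_num),
        Real.rpow_natCast, Real.rpow_inv_lt_iff_of_pos (by norm_num) (by norm_num) (by norm_num)]
      norm_num
    exact (Real.rpow_lt_rpow_of_exponent_lt (by norm_num) (by linarith [halfExp_lt])).trans h1
  have hb : (n / 3) ^ (2 * halfExp - 1) ≤ 1 + (2 * halfExp - 1) * (n / 3 - 1) := by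
    have := rpow_one_add_le_one_add_mul_self (s := n / 3 - 1) (by linarith)
      (p := 2 * halfExp - 1) (by linarith [halfExp_gt]) (by linarith [halfExp_lt])
    simpa using this
  have hb2 : (n / 3) ^ (2 * halfExp - 1) ≤ 1 + 0.586 * (n / 3 - 1) := by
    nlinarith [halfExp_lt]
  have e : (3 * n) ^ (2 * halfExp - 1) = 9 ^ (2 * halfExp - 1) * (n / 3) ^ (2 * halfExp - 1) := by
    rw [← Real.mul_rpow (by norm_num) (by linarith)]; congr 1; ring
  have hp : 0 < (3 * n) ^ (2 * halfExp - 1) := Real.rpow_pos_of_pos (by linarith) _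
  rw [one_div, Real.inv_rpow (by linarith), ← div_eq_mul_inv, lt_div_iff₀ hp, e]
  have : (9 : ℝ) ^ (2 * halfExp - 1) * (n / 3) ^ (2 * halfExp - 1)
      ≤ 3.63 * (1 + 0.586 * (n / 3 - 1)) :=
    mul_le_mul h9.le hb2 (Real.rpow_nonneg (by linarith) _) (by norm_num)
  linarith

/-- A concave function against an affine one: the inequality is checked at both ends. -/
theorem rpow_gt_of_ends {a b t α β c : ℝ} (hc : 0 ≤ c) (ha : 0 ≤ a) (hat : a ≤ t) (htb : t ≤ b)
    (h1 : α + β * a < c * a ^ (2 * halfExp - 1)) (h2 : α + β * b < c * b ^ (2 * halfExp - 1)) :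
    α + β * t < c * t ^ (2 * halfExp - 1) := by
  have hF : ConcaveOn ℝ (Set.Ici 0) fun t : ℝ => c * t ^ (2 * halfExp - 1) - (α + β * t) := by
    refine (concaveOn_rpow_sub_one.smul hc).sub ⟨convex_Ici 0, ?_⟩
    intro x _ y _ p q _ _ hpq
    have : p = 1 - q := by linarith
    subst this
    simp only [smul_eq_mul]; apply le_of_eq; ring
  have := hF.min_le_of_mem_Icc (x := a) (y := b) (z := t) ha (ha.trans (hat.trans htb)) ⟨hat, htb⟩
  have h3 : 0 < c * t ^ (2 * halfExp - 1) - (α + β * t) :=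
    lt_of_lt_of_le (lt_min (by linarith) (by linarith)) this
  linarith

/-- The numerical condition of the chord bound with slope `0.18`. -/
theorem rpow_gt_of_mid {n a : ℝ} (hn : 3 ≤ n) (h1 : 1 / (3 * n) ≤ a) (h2 : a ≤ 1 / 8) :
    0.82 * (1 + n * a) < (n + 1) * a ^ (2 * halfExp - 1) := by
  have h8 := half_pow_rpow 3
  norm_num at h8
  have := rpow_gt_of_ends (a := 1 / (3 * n)) (b := 1 / 8) (t := a) (α := 0.82) (β := 0.82 * n)
    (c := n + 1) (by linarith) (by positivity) h1 h2 ?_ ?_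
  · linarith
  · have := threshold_ineq hn
    have e : 0.82 * n * (1 / (3 * n)) = 0.82 / 3 := by field_simp
    rw [e]; linarith
  · rw [h8]; linarith

/-- The numerical condition of the chord bound with slope `0.15`. -/
theorem rpow_gt_of_large {n a : ℝ} (hn : 3 ≤ n) (h1 : 1 / 8 ≤ a) (h2 : a ≤ 1 / 4) :
    0.85 * (1 + n * a) < (n + 1) * a ^ (2 * halfExp - 1) := by
  have h8 := half_pow_rpow 3
  have h4 := half_pow_rpow 2
  norm_num at h8 h4
  have := rpow_gt_of_ends (a := 1 / 8) (b := 1 / 4) (t := a) (α := 0.85) (β := 0.85 * n)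
    (c := n + 1) (by linarith) (by positivity) h1 h2 ?_ ?_
  · linarith
  · rw [h8]; linarith
  · rw [h4]; linarith

/-! ### A third line near an almost orthogonal pair -/

/-- The squared inner products of three unit vectors in the plane satisfy the hypothesis `h`
(vanishing of the Gram determinant, see `sqInner_gram`). It implies that the sum of two of them is at least `1` minus the absolute value of the third inner product. -/
theorem one_sub_sqrt_le_add {x u v : ℝ} (hx : 0 ≤ x) (hu : 0 ≤ u) (hv : 0 ≤ v)
    (h : (u + v + x - 1) ^ 2 = 4 * x * u * v) : 1 - √x ≤ u + v := by
  have ha := Real.sqrt_nonneg x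
  have hs := Real.sq_sqrt hx
  set a := √x
  have h1 : (u + v + x - 1) ^ 2 ≤ (a * (u + v)) ^ 2 := by
    rw [h, mul_pow, hs]; nlinarith [sq_nonneg (u - v)]
  have h2 := (abs_le.1 (abs_le_of_sq_le_sq h1 (by positivity))).1
  by_contra hc
  push Not at hc
  nlinarith

/-- The numerical condition for pairs very close to orthogonal; `3.28 = 4 * 0.82`. -/
theorem rpow_gt_of_small {n a : ℝ} (hn : 3 ≤ n) (h0 : 0 < a) (h1 : a ≤ 1 / (3 * n)) :
    3.28 * n * a < (n + 1) * a ^ (2 * halfExp - 1) := by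
  have hn0 : 0 < 3 * n := by linarith
  have hs1 : 3 * n * a ≤ 1 := by rwa [le_div_iff₀ hn0, mul_comm] at h1
  have hs0 : 0 < 3 * n * a := by positivity
  have hs := Real.rpow_le_rpow_of_exponent_ge hs0 hs1
    (show 2 * halfExp - 1 ≤ 1 by linarith [halfExp_lt_one])
  rw [Real.rpow_one] at hs
  have e : a ^ (2 * halfExp - 1)
      = (3 * n * a) ^ (2 * halfExp - 1) * (1 / (3 * n)) ^ (2 * halfExp - 1) := by
    rw [← Real.mul_rpow hs0.le (by positivity)]; congr 1; field_simp
  have ht := threshold_ineq hn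
  have hp : 0 < (1 / (3 * n)) ^ (2 * halfExp - 1) := Real.rpow_pos_of_pos (by positivity) _
  rw [e]
  calc 3.28 * n * a = 3 * n * a * (0.82 * (4 / 3)) := by ring
    _ < 3 * n * a * ((n + 1) * (1 / (3 * n)) ^ (2 * halfExp - 1)) := mul_lt_mul_of_pos_left ht hs0
    _ = (n + 1) * (3 * n * a * (1 / (3 * n)) ^ (2 * halfExp - 1)) := by ring
    _ ≤ _ := by gcongr

/-- For `a ≤ b ≤ 1/2` with `a` small, `b ^ p` with `p = 2 * halfExp` dominates
`0.82 * (a + b) ^ 2` up to the share `a ^ p / n` of the nearly orthogonal pair. -/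
theorem sq_add_lt_rpow {n a b : ℝ} (hn : 3 ≤ n) (h0 : 0 < a) (h1 : a ≤ 1 / (3 * n)) (hab : a ≤ b)
    (hb : b ≤ 1 / 2) : 0.82 * (a + b) ^ 2
      < b * b ^ (2 * halfExp - 1) + a * a ^ (2 * halfExp - 1) / n := by
  have ha9 : a ≤ 1 / 9 := h1.trans (one_div_le_one_div_of_le (by norm_num) (by linarith))
  have hA := rpow_gt_of_small hn h0 h1
  have hd : 0 < 1 / 2 - a := by linarith
  -- `b` is the convex combination of `a` and `1 / 2` with weight `w`
  obtain ⟨w, hw⟩ : ∃ w, w = (b - a) / (1 / 2 - a) := ⟨_, rfl⟩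
  have hw0 : 0 ≤ w := by rw [hw]; exact div_nonneg (by linarith) hd.le
  have hw1 : w ≤ 1 := by rw [hw, div_le_one hd]; linarith
  have hbw : (1 - w) * a + w * (1 / 2) = b := by
    have : w * (1 / 2 - a) = b - a := by rw [hw, div_mul_cancel₀ _ hd.ne']
    linarith
  have hB := concaveOn_rpow_sub_one.2 (show a ∈ Set.Ici 0 from h0.le)
    (show (1 / 2 : ℝ) ∈ Set.Ici 0 by simp) (show 0 ≤ 1 - w by linarith) hw0 (by ring)
  have h2 := half_pow_rpow 1
  rw [pow_one, pow_one] at h2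
  simp only [smul_eq_mul] at hB
  rw [hbw, h2] at hB
  set A := a ^ (2 * halfExp - 1)
  set B := b ^ (2 * halfExp - 1)
  obtain ⟨k, hk⟩ : ∃ k, k = 1 / (n + 1) := ⟨_, rfl⟩
  have hk0 : 0 < k := by rw [hk]; positivity
  have hk4 : k ≤ 1 / 4 := by rw [hk]; exact one_div_le_one_div_of_le (by norm_num) (by linarith)
  have hnk : n * k = 1 - k := by rw [hk]; field_simp; ring
  have hA' : 3.28 * (1 - k) * a < A := by
    have : 3.28 * n * a * k < (n + 1) * A * k := mul_lt_mul_of_pos_right hA hk0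
    have e1 : (n + 1) * A * k = A := by linear_combination A * hnk
    have e2 : 3.28 * n * a * k = 3.28 * (1 - k) * a := by linear_combination 3.28 * a * hnk
    linarith
  have hAn : 3.28 * k * a ^ 2 < a * A / n := by
    rw [lt_div_iff₀ (by linarith)]
    have : 3.28 * (1 - k) * a * a < A * a := mul_lt_mul_of_pos_right hA' h0
    have e : 3.28 * k * a ^ 2 * n = 3.28 * (1 - k) * a * a := by linear_combination 3.28 * a ^ 2 * hnk
    linarith
  have hbB : b * ((1 - w) * (3.28 * (1 - k) * a) + w * (2 / 3)) ≤ b * B := by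
    apply mul_le_mul_of_nonneg_left _ (by linarith)
    have := mul_le_mul_of_nonneg_left hA'.le (show 0 ≤ 1 - w by linarith)
    linarith
  have key : 0.82 * (a + b) ^ 2 ≤
      b * ((1 - w) * (3.28 * (1 - k) * a) + w * (2 / 3)) + 3.28 * k * a ^ 2 := by
    have e : b * ((1 - w) * (3.28 * (1 - k) * a) + w * (2 / 3)) + 3.28 * k * a ^ 2
        - 0.82 * (a + b) ^ 2 = w * ((0.82 - 3.28 * k) * (a * ((1 - w) * (1 / 2 - a) - a))
          + b * (2 / 3 - 0.41 - 1.64 * a)) := by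
      rw [← hbw]; ring
    have h3 : 0.07 * b ≤ b * (2 / 3 - 0.41 - 1.64 * a) := by nlinarith
    have h4 : -(0.07 * b) ≤ 0.82 * (a * ((1 - w) * (1 / 2 - a) - a)) := by
      rw [← hbw]
      have : 0 ≤ (1 - w) * a * (1 / 9 - a) :=
        mul_nonneg (mul_nonneg (by linarith) h0.le) (by linarith)
      nlinarith [mul_nonneg (show 0 ≤ 1 - w by linarith) h0.le]
    have h5 : -(0.07 * b) ≤ (0.82 - 3.28 * k) * (a * ((1 - w) * (1 / 2 - a) - a)) := by
      rcases le_total 0 (a * ((1 - w) * (1 / 2 - a) - a)) with h | h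
      · have := mul_nonneg (show 0 ≤ 0.82 - 3.28 * k by linarith) h
        linarith
      · nlinarith
    have := mul_nonneg hw0 (show 0 ≤ (0.82 - 3.28 * k) * (a * ((1 - w) * (1 / 2 - a) - a))
          + b * (2 / 3 - 0.41 - 1.64 * a) by linarith)
    linarith
  linarith

/-- If two lines are nearly orthogonal, with squared inner product `x`, then a third line, with
squared inner products `u` and `v` to them, contributes more than `1 - x ^ halfExp / n`. -/
theorem one_lt_rpow_add_rpow {n x u v : ℝ} (hn : 3 ≤ n) (hx : 0 < x) (hxn : √x ≤ 1 / (3 * n))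
    (hxu : x ≤ u) (hxv : x ≤ v) (hu : u ≤ 1) (hv : v ≤ 1)
    (h : (u + v + x - 1) ^ 2 = 4 * x * u * v) :
    1 < u ^ halfExp + v ^ halfExp + x ^ halfExp / n := by
  wlog huv : u ≤ v generalizing u v
  · have := this hxv hxu hv hu (by linarith) (by linarith)
    linarith
  have hu0 : 0 < u := hx.trans_le hxu
  have hv0 : 0 < v := hx.trans_le hxv
  have gu := gain_nonneg hu0.le hu
  have gv := gain_nonneg hv0.le hv
  have hxp : 0 < x ^ halfExp / n := div_pos (Real.rpow_pos_of_pos hx _) (by linarith)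
  have ha9 : √x ≤ 1 / 9 := hxn.trans (one_div_le_one_div_of_le (by norm_num) (by linarith))
  have eu : u ^ halfExp = gain u + u := by simp [gain]
  have ev : v ^ halfExp = gain v + v := by simp [gain]
  rcases le_or_gt 1 (u + v) with hd | hd
  · linarith
  have hd2 := one_sub_sqrt_le_add hx.le hu0.le hv0.le h
  rcases le_total v (3 / 4) with h3 | h3
  · have h1 := min_gain_le (s := 1 / 8) (t := 1 / 2) (u := u) (by norm_num) (by linarith)
      (by linarith)
    have h2 := min_gain_le (s := 1 / 8) (t := 3 / 4) (u := v) (by norm_num) (by linarith)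
      (by linarith)
    have m1 : (0.067 : ℝ) ≤ min (gain (1 / 8)) (gain (1 / 2)) :=
      le_min gain_eighth.le (by linarith [gain_half])
    have m2 : (0.045 : ℝ) ≤ min (gain (1 / 8)) (gain (3 / 4)) :=
      le_min (by linarith [gain_eighth]) gain_three_quarters.le
    linarith
  · have h1 := le_gain_of_chord (τ := 0.18) (by norm_num) (by norm_num)
      (by linarith [gain_three_quarters]) h3 hv
    have hb2 : √u ≤ 1 / 2 := Real.sqrt_le_iff.2 ⟨by norm_num, by linarith⟩
    have key := sq_add_lt_rpow hn (Real.sqrt_pos.2 hx) hxn (Real.sqrt_le_sqrt hxu) hb2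
    rw [sqrt_rpow hx, sqrt_rpow hu0] at key
    have h4 : (u + v + x - 1) ^ 2 ≤ (2 * (√x * √u)) ^ 2 := by
      rw [h, mul_pow, mul_pow, Real.sq_sqrt hx.le, Real.sq_sqrt hu0.le]
      nlinarith [mul_pos hx hu0]
    have h5 := (abs_le.1 (abs_le_of_sq_le_sq h4 (by positivity))).1
    have h6 : (√x + √u) ^ 2 = x + u + 2 * (√x * √u) := by
      rw [add_sq, Real.sq_sqrt hx.le, Real.sq_sqrt hu0.le]; ring
    rw [h6] at key
    linarith

/-! ### Two equal angles -/

theorem one_le_rpow_add_rpow_one_sub {u : ℝ} (h0 : 0 ≤ u) (h1 : u ≤ 1) :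
    1 ≤ u ^ halfExp + (1 - u) ^ halfExp := by
  have a := gain_nonneg h0 h1
  have b := gain_nonneg (sub_nonneg.2 h1) (by linarith)
  simp only [gain] at a b
  linarith

theorem eq_zero_or_one_of_rpow {u : ℝ} (h0 : 0 ≤ u) (h1 : u ≤ 1)
    (h : u ^ halfExp + (1 - u) ^ halfExp ≤ 1) : u = 0 ∨ u = 1 := by
  by_contra hc
  push Not at hc
  have a := gain_pos (h0.lt_of_ne' hc.1) (h1.lt_of_ne hc.2)
  have b := gain_nonneg (sub_nonneg.2 h1) (by linarith)
  simp only [gain] at a b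
  linarith

/-- With `p = 2 * halfExp` and `y = sin s ^ 2`, this is twice the logarithm of
`sin s ^ (p - 1) * cos s`, which is the derivative of `sin ^ p` at `s` divided by `p`. -/
noncomputable def logSlope (y : ℝ) : ℝ := (2 * halfExp - 1) * Real.log y + Real.log (1 - y)

theorem logSlope_strictConcaveOn : StrictConcaveOn ℝ (Set.Ioo 0 1) logSlope := by
  have h1 : StrictConcaveOn ℝ (Set.Ioo (0 : ℝ) 1) Real.log :=
    strictConcaveOn_log_Ioi.subset (fun x hx => hx.1) (convex_Ioo 0 1)
  refine ⟨convex_Ioo 0 1, fun x hx y hy hxy a b ha hb hab => ?_⟩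
  have e1 := h1.2 hx hy hxy ha hb hab
  have e2 := h1.2 (x := 1 - x) ⟨by linarith [hx.2], by linarith [hx.1]⟩ (y := 1 - y)
    ⟨by linarith [hy.2], by linarith [hy.1]⟩ (by contrapose! hxy; linarith) ha hb hab
  simp only [smul_eq_mul] at e1 e2 ⊢
  have e3 : a * (1 - x) + b * (1 - y) = 1 - (a * x + b * y) := by linear_combination hab
  rw [e3] at e2
  have hr : 0 < 2 * halfExp - 1 := by linarith [halfExp_gt]
  have := mul_lt_mul_of_pos_left e1 hr
  simp only [logSlope]
  linarith

/-- A strictly concave function does not take the same value three times. -/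
theorem two_eq_of_logSlope_eq {x y z : ℝ} (hx : x ∈ Set.Ioo (0 : ℝ) 1) (hy : y ∈ Set.Ioo (0 : ℝ) 1)
    (hz : z ∈ Set.Ioo (0 : ℝ) 1) (hxy : logSlope x = logSlope y) (hyz : logSlope y = logSlope z) :
    x = y ∨ y = z ∨ x = z := by
  by_contra hc
  push Not at hc
  have aux : ∀ a b c : ℝ, a ∈ Set.Ioo (0 : ℝ) 1 → c ∈ Set.Ioo (0 : ℝ) 1 → a < b → b < c →
      logSlope a = logSlope b → logSlope b = logSlope c → False := by
    intro a b c ha hc hab hbc h1 h2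
    have hb : b ∈ openSegment ℝ a c := by rw [openSegment_eq_Ioo (hab.trans hbc)]; exact ⟨hab, hbc⟩
    have := logSlope_strictConcaveOn.lt_on_openSegment ha hc (hab.trans hbc).ne hb
    rw [h1, h2, min_self] at this
    linarith
  rcases lt_or_gt_of_ne hc.1 with h1 | h1 <;> rcases lt_or_gt_of_ne hc.2.1 with h2 | h2 <;>
    rcases lt_or_gt_of_ne hc.2.2 with h3 | h3
  · exact aux x y z hx hz h1 h2 hxy hyz
  · linarith
  · exact aux x z y hx hy h3 h2 (hxy.trans hyz) hyz.symm
  · exact aux z x y hz hy h3 h1 (hxy.trans hyz).symm hxy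
  · exact aux y x z hy hz h1 h3 hxy.symm (hxy.trans hyz)
  · exact aux y z x hy hx h2 h3 hyz (hxy.trans hyz).symm
  · linarith
  · exact aux z y x hz hx h2 h1 hyz.symm hxy.symm

/-- For two equal angles with sine `S` and the angle that completes them to `π / 2`, the sum
`2 S ^ p + (1 - 2 S ^ 2) ^ p`, `p = 2 * halfExp`, is increasing in `S` where this convex function of
`y = S ^ 2` is positive and decreasing where it is negative. -/
noncomputable def isoSign (y : ℝ) : ℝ :=
  (halfExp - 1) * Real.log y - Real.log 2 - (2 * halfExp - 1) * Real.log (1 - 2 * y)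

theorem isoSign_convexOn : ConvexOn ℝ (Set.Ioo 0 (1 / 2)) isoSign := by
  have h1 : ConcaveOn ℝ (Set.Ioi (0 : ℝ)) Real.log := strictConcaveOn_log_Ioi.concaveOn
  refine ⟨convex_Ioo 0 _, fun x hx y hy a b ha hb hab => ?_⟩
  have e1 := h1.2 (show x ∈ Set.Ioi 0 from hx.1) (show y ∈ Set.Ioi 0 from hy.1) ha hb hab
  have e2 := h1.2 (show 1 - 2 * x ∈ Set.Ioi 0 from by simp; linarith [hx.2])
    (show 1 - 2 * y ∈ Set.Ioi 0 from by simp; linarith [hy.2]) ha hb hab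
  simp only [smul_eq_mul] at e1 e2 ⊢
  have e3 : a * (1 - 2 * x) + b * (1 - 2 * y) = 1 - 2 * (a * x + b * y) := by
    linear_combination hab
  rw [e3] at e2
  have hr : 0 < 2 * halfExp - 1 := by linarith [halfExp_gt]
  have hr1 : 0 < 1 - halfExp := by linarith [halfExp_lt_one]
  have f1 := mul_le_mul_of_nonneg_left e1 hr1.le
  have f2 := mul_le_mul_of_nonneg_left e2 hr.le
  have e4 : Real.log 2 = (a + b) * Real.log 2 := by rw [hab, one_mul]
  simp only [isoSign]
  linarith

theorem isoSign_quarter : isoSign (1 / 4) = 0 := by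
  have h4 : Real.log (1 / 4) = -(2 * Real.log 2) := by
    rw [show (1 / 4 : ℝ) = (2 ^ 2)⁻¹ by norm_num, Real.log_inv, Real.log_pow]; norm_num
  have h2 : Real.log (1 - 2 * (1 / 4)) = - Real.log 2 := by
    rw [show (1 - 2 * (1 / 4) : ℝ) = 2⁻¹ by norm_num, Real.log_inv]
  rw [isoSign, h4, h2]; ring

theorem isoSign_eighth : isoSign (1 / 8) < 0 := by
  have h8 : Real.log (1 / 8) = -(3 * Real.log 2) := by
    rw [show (1 / 8 : ℝ) = (2 ^ 3)⁻¹ by norm_num, Real.log_inv, Real.log_pow]; norm_num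
  have h3 : Real.log (1 - 2 * (1 / 8)) = Real.log 3 - 2 * Real.log 2 := by
    rw [show (1 - 2 * (1 / 8) : ℝ) = 3 / 2 ^ 2 by norm_num, Real.log_div (by norm_num) (by norm_num),
      Real.log_pow]; norm_num
  have hl : 0 < Real.log 2 := Real.log_pos (by norm_num)
  have e : isoSign (1 / 8) = Real.log 2 * (halfExp * (3 - 4 * halfExp)) := by
    rw [isoSign, h8, h3, log_three_eq]; ring
  rw [e]
  exact mul_neg_of_pos_of_neg hl
    (mul_neg_of_pos_of_neg halfExp_pos (by linarith [halfExp_gt]))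

theorem iso_hasDerivAt (S : ℝ) :
    HasDerivAt (fun S : ℝ => 2 * S ^ (2 * halfExp) + (1 - 2 * S ^ 2) ^ (2 * halfExp))
      (4 * halfExp * (S ^ (2 * halfExp - 1) - 2 * S * (1 - 2 * S ^ 2) ^ (2 * halfExp - 1))) S := by
  have hp : 1 ≤ 2 * halfExp := by linarith [halfExp_gt]
  have a := ((hasDerivAt_id' S).rpow_const (p := 2 * halfExp) (Or.inr hp)).const_mul 2
  have b := ((((hasDerivAt_id' S).fun_pow 2).const_mul 2).const_sub 1).rpow_const
    (p := 2 * halfExp) (Or.inr hp)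
  refine (a.fun_add b).congr_deriv ?_
  norm_num
  ring

theorem isoSign_sq {S : ℝ} (h0 : 0 < S) (h1 : 2 * S ^ 2 < 1) :
    isoSign (S ^ 2) = Real.log (S ^ (2 * halfExp - 1))
      - Real.log (2 * S * (1 - 2 * S ^ 2) ^ (2 * halfExp - 1)) := by
  have hc : 0 < 1 - 2 * S ^ 2 := by linarith
  have hq := Real.rpow_pos_of_pos hc (2 * halfExp - 1)
  rw [Real.log_mul (by positivity) hq.ne', Real.log_mul (by norm_num) h0.ne',
    Real.log_rpow h0, Real.log_rpow hc, isoSign, Real.log_pow]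
  push_cast; ring

/-- `isoSign (S ^ 2)` has the sign of the derivative in `iso_hasDerivAt`. -/
theorem isoSign_pos_iff {S : ℝ} (h0 : 0 < S) (h1 : 2 * S ^ 2 < 1) :
    0 < isoSign (S ^ 2) ↔
      0 < S ^ (2 * halfExp - 1) - 2 * S * (1 - 2 * S ^ 2) ^ (2 * halfExp - 1) := by
  have hq := Real.rpow_pos_of_pos (show 0 < 1 - 2 * S ^ 2 by linarith) (2 * halfExp - 1)
  rw [isoSign_sq h0 h1, sub_pos, sub_pos,
    Real.log_lt_log_iff (by positivity) (Real.rpow_pos_of_pos h0 _)]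

theorem isoSign_neg_iff {S : ℝ} (h0 : 0 < S) (h1 : 2 * S ^ 2 < 1) :
    isoSign (S ^ 2) < 0 ↔
      S ^ (2 * halfExp - 1) - 2 * S * (1 - 2 * S ^ 2) ^ (2 * halfExp - 1) < 0 := by
  have hq := Real.rpow_pos_of_pos (show 0 < 1 - 2 * S ^ 2 by linarith) (2 * halfExp - 1)
  rw [isoSign_sq h0 h1, sub_neg, sub_neg,
    Real.log_lt_log_iff (Real.rpow_pos_of_pos h0 _) (by positivity)]

/-- The three-angle inequality when two of the angles agree, with equality at `S = 1 / 2`. A value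
below `1` would force `isoSign` to change sign in a way that contradicts its convexity and the
values `isoSign (1 / 4) = 0`, `isoSign (1 / 8) < 0`. -/
theorem one_le_iso {S : ℝ} (h0 : 0 < S) (h1 : 2 * S ^ 2 < 1) :
    1 ≤ 2 * S ^ (2 * halfExp) + (1 - 2 * S ^ 2) ^ (2 * halfExp) := by
  set f : ℝ → ℝ := fun S => 2 * S ^ (2 * halfExp) + (1 - 2 * S ^ 2) ^ (2 * halfExp) with hf
  set f' : ℝ → ℝ := fun S =>
    4 * halfExp * (S ^ (2 * halfExp - 1) - 2 * S * (1 - 2 * S ^ 2) ^ (2 * halfExp - 1)) with hf'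
  have hp : 0 < 4 * halfExp := by linarith [halfExp_pos]
  have hp0 : 2 * halfExp ≠ 0 := by linarith [halfExp_pos]
  have f0 : f 0 = 1 := by simp [hf, Real.zero_rpow hp0]
  have fh : f (1 / 2) = 1 := by
    have : ((1 / 2 : ℝ)) ^ (2 * halfExp) = 1 / 3 := by
      rw [Real.rpow_mul (by norm_num)]
      have := quarter_rpow 1
      norm_num at this ⊢; exact this
    have e : (1 - 2 * (1 / 2 : ℝ) ^ 2) = 1 / 2 := by norm_num
    simp only [hf, e, this]; norm_num
  have hder : ∀ T : ℝ, 2 * T ^ 2 < 1 → HasDerivAt f (f' T) T := fun T _ => iso_hasDerivAt T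
  have mvt : ∀ a b : ℝ, 0 ≤ a → a < b → 2 * b ^ 2 < 1 → ∃ c ∈ Set.Ioo a b,
      f' c = (f b - f a) / (b - a) := by
    intro a b ha hab hb
    refine exists_hasDerivAt_eq_slope f f' hab (fun c hc => ?_) (fun c hc => ?_)
    · exact (hder c (by nlinarith [hc.1, hc.2])).continuousAt.continuousWithinAt
    · exact hder c (by nlinarith [hc.1, hc.2])
  change 1 ≤ f S
  by_contra hlt
  push Not at hlt
  rcases lt_trichotomy S (1 / 2) with hS | hS | hS
  · obtain ⟨c, hc, hc'⟩ := mvt 0 S le_rfl h0 h1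
    obtain ⟨d, hd, hd'⟩ := mvt S (1 / 2) h0.le hS (by norm_num)
    have n1 : f' c < 0 := by
      rw [hc']; exact div_neg_of_neg_of_pos (by linarith) (by linarith)
    have n2 : 0 < f' d := by rw [hd']; exact div_pos (by linarith) (by linarith)
    have c1 : 2 * c ^ 2 < 1 := by nlinarith [hc.1, hc.2]
    have d1 : 2 * d ^ 2 < 1 := by nlinarith [hd.1, hd.2]
    have s1 : isoSign (c ^ 2) < 0 := (isoSign_neg_iff hc.1 c1).2 (by
      by_contra h; push Not at h
      exact absurd (mul_nonneg hp.le h) (not_le.2 n1))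
    have s2 : 0 < isoSign (d ^ 2) := (isoSign_pos_iff (h0.trans hd.1) d1).2
      (pos_of_mul_pos_right n2 hp.le)
    have := isoSign_convexOn.le_max_of_mem_Icc (x := c ^ 2) (y := 1 / 4) (z := d ^ 2)
      ⟨pow_pos hc.1 2, by linarith⟩ (by norm_num)
      ⟨by nlinarith [hc.1, hc.2, hd.1, hd.2], by nlinarith [hd.1, hd.2]⟩
    rw [isoSign_quarter, max_eq_right s1.le] at this
    linarith
  · rw [hS, fh] at hlt; linarith
  · obtain ⟨c, hc, hc'⟩ := mvt (1 / 2) S (by norm_num) hS h1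
    have n1 : f' c < 0 := by
      rw [hc']; exact div_neg_of_neg_of_pos (by linarith) (by linarith)
    have c0 : 0 < c := by linarith [hc.1]
    have c1 : 2 * c ^ 2 < 1 := by nlinarith [hc.1, hc.2]
    have s1 : isoSign (c ^ 2) < 0 := (isoSign_neg_iff c0 c1).2 (by
      by_contra h; push Not at h
      exact absurd (mul_nonneg hp.le h) (not_le.2 n1))
    have := isoSign_convexOn.le_max_of_mem_Icc (x := 1 / 8) (y := c ^ 2) (z := 1 / 4)
      (by norm_num) ⟨by positivity, by linarith⟩
      ⟨by norm_num, by nlinarith [hc.1]⟩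
    rw [isoSign_quarter] at this
    have := lt_of_le_of_lt this (max_lt isoSign_eighth s1)
    linarith

/-! ### Three angles -/

theorem sq_rpow_halfExp {y : ℝ} (hy : 0 ≤ y) : (y ^ 2) ^ halfExp = y ^ (2 * halfExp) := by
  rw [Real.rpow_mul hy, Real.rpow_two]

theorem one_le_sin_rpow_add_cos_rpow {t : ℝ} (h0 : 0 ≤ t) (h1 : t ≤ Real.pi / 2) :
    1 ≤ Real.sin t ^ (2 * halfExp) + Real.cos t ^ (2 * halfExp) := by
  have hs : 0 ≤ Real.sin t := Real.sin_nonneg_of_nonneg_of_le_pi h0 (by linarith [Real.pi_pos])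
  have hc : 0 ≤ Real.cos t := Real.cos_nonneg_of_neg_pi_div_two_le_of_le (by linarith) h1
  have := one_le_rpow_add_rpow_one_sub (sq_nonneg (Real.sin t)) (Real.sin_sq_le_one t)
  rwa [← Real.cos_sq', sq_rpow_halfExp hs, sq_rpow_halfExp hc] at this

theorem logSlope_sin_sq_eq {s w : ℝ} (hs0 : 0 < s) (hs1 : s < Real.pi / 2) (hw0 : 0 < w)
    (hw1 : w < Real.pi / 2)
    (h : Real.sin s ^ (2 * halfExp - 1) * Real.cos s
      = Real.sin w ^ (2 * halfExp - 1) * Real.cos w) :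
    logSlope (Real.sin s ^ 2) = logSlope (Real.sin w ^ 2) := by
  have aux : ∀ z : ℝ, 0 < z → z < Real.pi / 2 → logSlope (Real.sin z ^ 2)
      = 2 * Real.log (Real.sin z ^ (2 * halfExp - 1) * Real.cos z) := by
    intro z h0 h1
    have hs : 0 < Real.sin z := Real.sin_pos_of_pos_of_lt_pi h0 (by linarith [Real.pi_pos])
    have hc : 0 < Real.cos z := Real.cos_pos_of_mem_Ioo ⟨by linarith, h1⟩
    rw [Real.log_mul (Real.rpow_pos_of_pos hs _).ne' hc.ne', Real.log_rpow hs, logSlope,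
      ← Real.cos_sq', Real.log_pow, Real.log_pow]
    push_cast; ring
  rw [aux s hs0 hs1, aux w hw0 hw1, h]

theorem sin_sq_mem_Ioo {z : ℝ} (h0 : 0 < z) (h1 : z < Real.pi / 2) :
    Real.sin z ^ 2 ∈ Set.Ioo (0 : ℝ) 1 := by
  have hs : 0 < Real.sin z := Real.sin_pos_of_pos_of_lt_pi h0 (by linarith [Real.pi_pos])
  have hc : 0 < Real.cos z := Real.cos_pos_of_mem_Ioo ⟨by linarith, h1⟩
  exact ⟨by positivity, by nlinarith [Real.sin_sq_add_cos_sq z]⟩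

theorem eq_of_sin_sq_eq {s w : ℝ} (hs0 : 0 < s) (hs1 : s < Real.pi / 2) (hw0 : 0 < w)
    (hw1 : w < Real.pi / 2) (h : Real.sin s ^ 2 = Real.sin w ^ 2) : s = w := by
  have h1 : 0 ≤ Real.sin s := Real.sin_nonneg_of_nonneg_of_le_pi hs0.le (by linarith)
  have h2 : 0 ≤ Real.sin w := Real.sin_nonneg_of_nonneg_of_le_pi hw0.le (by linarith)
  exact Real.injOn_sin ⟨by linarith, hs1.le⟩ ⟨by linarith, hw1.le⟩
    ((pow_left_inj₀ h1 h2 two_ne_zero).1 h)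

/-- At a critical point of `sin s ^ p + cos (s + t) ^ p` in `s`, with `p = 2 * halfExp`, the angles
`s` and `π / 2 - s - t` have the same value of `logSlope`. -/
theorem logSlope_eq_of_isLocalMin {s t c : ℝ} (hs : 0 < s) (ht : 0 < t)
    (hst : s + t < Real.pi / 2)
    (h : IsLocalMin (fun z => Real.sin z ^ (2 * halfExp) + c
      + Real.cos (z + t) ^ (2 * halfExp)) s) :
    logSlope (Real.sin s ^ 2) = logSlope (Real.sin (Real.pi / 2 - s - t) ^ 2) := by
  have hp : 1 ≤ 2 * halfExp := by linarith [halfExp_gt]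
  have a := (((Real.hasDerivAt_sin s).rpow_const (p := 2 * halfExp) (Or.inr hp)).add_const c)
  have b := (((hasDerivAt_id' s).add_const t).cos).rpow_const (p := 2 * halfExp) (Or.inr hp)
  have e := h.hasDerivAt_eq_zero (a.fun_add b)
  apply logSlope_sin_sq_eq hs (by linarith) (by linarith) (by linarith)
  rw [show Real.pi / 2 - s - t = Real.pi / 2 - (s + t) by ring, Real.sin_pi_div_two_sub,
    Real.cos_pi_div_two_sub]
  have h2 : 2 * halfExp * (Real.sin s ^ (2 * halfExp - 1) * Real.cos s
      - Real.cos (s + t) ^ (2 * halfExp - 1) * Real.sin (s + t)) = 0 := by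
    rw [← e]; ring
  rcases mul_eq_zero.1 h2 with h3 | h3
  · linarith
  · linarith

theorem one_le_iso_angle {s : ℝ} (h0 : 0 < s) (h1 : s + s < Real.pi / 2) :
    1 ≤ Real.sin s ^ (2 * halfExp) + Real.sin s ^ (2 * halfExp)
      + Real.cos (s + s) ^ (2 * halfExp) := by
  have hs : 0 < Real.sin s := Real.sin_pos_of_pos_of_lt_pi h0 (by linarith)
  have hc : 0 < Real.cos (s + s) := Real.cos_pos_of_mem_Ioo ⟨by linarith, h1⟩
  have e : Real.cos (s + s) = 1 - 2 * Real.sin s ^ 2 := by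
    rw [← two_mul, Real.cos_two_mul, Real.cos_sq']; ring
  rw [e] at hc ⊢
  have := one_le_iso hs (by linarith)
  linarith

/-- Three nonnegative angles with sum `π / 2`. The minimum over the compact triangle of angles is
either on the boundary, where one angle vanishes, or at a critical point, where all three angles
have the same `logSlope`, so that two of them agree by strict concavity. -/
theorem one_le_three_angles {s t : ℝ} (hs : 0 ≤ s) (ht : 0 ≤ t) (hst : s + t ≤ Real.pi / 2) :
    1 ≤ Real.sin s ^ (2 * halfExp) + Real.sin t ^ (2 * halfExp)
      + Real.cos (s + t) ^ (2 * halfExp) := by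
  have hp : 0 ≤ 2 * halfExp := by linarith [halfExp_pos]
  have hp0 : 2 * halfExp ≠ 0 := by linarith [halfExp_pos]
  set K : Set (ℝ × ℝ) := {q | 0 ≤ q.1 ∧ 0 ≤ q.2 ∧ q.1 + q.2 ≤ Real.pi / 2} with hK
  set F : ℝ × ℝ → ℝ := fun q => Real.sin q.1 ^ (2 * halfExp) + Real.sin q.2 ^ (2 * halfExp)
      + Real.cos (q.1 + q.2) ^ (2 * halfExp) with hF
  have hKc : IsCompact K := by
    have hcl : IsClosed K := by
      apply IsClosed.inter (isClosed_le continuous_const continuous_fst)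
      exact IsClosed.inter (isClosed_le continuous_const continuous_snd)
        (isClosed_le (continuous_fst.add continuous_snd) continuous_const)
    apply ((isCompact_Icc (a := (0 : ℝ)) (b := Real.pi / 2)).prod
      (isCompact_Icc (a := (0 : ℝ)) (b := Real.pi / 2))).of_isClosed_subset hcl
    rintro ⟨a, b⟩ ⟨h1, h2, h3⟩
    simp only at h1 h2 h3
    exact ⟨⟨h1, by linarith⟩, ⟨h2, by linarith⟩⟩
  have hFc : Continuous F := by
    refine ((Continuous.rpow_const (by fun_prop) fun _ => Or.inr hp).add
      (Continuous.rpow_const (by fun_prop) fun _ => Or.inr hp)).add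
      (Continuous.rpow_const (by fun_prop) fun _ => Or.inr hp)
  obtain ⟨⟨a, b⟩, ⟨ha, hb, hab⟩, hmin⟩ := hKc.exists_isMinOn ⟨(s, t), hs, ht, hst⟩ hFc.continuousOn
  have hmin' : ∀ y z : ℝ, 0 ≤ y → 0 ≤ z → y + z ≤ Real.pi / 2 →
      Real.sin a ^ (2 * halfExp) + Real.sin b ^ (2 * halfExp) + Real.cos (a + b) ^ (2 * halfExp)
        ≤ Real.sin y ^ (2 * halfExp) + Real.sin z ^ (2 * halfExp)
          + Real.cos (y + z) ^ (2 * halfExp) :=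
    fun y z hy hz hyz => isMinOn_iff.1 hmin (y, z) ⟨hy, hz, hyz⟩
  refine le_trans ?_ (hmin' s t hs ht hst)
  simp only at ha hb hab
  rcases ha.eq_or_lt with rfl | ha
  · have := one_le_sin_rpow_add_cos_rpow hb (by linarith)
    simpa [Real.zero_rpow hp0] using this
  rcases hb.eq_or_lt with rfl | hb
  · have := one_le_sin_rpow_add_cos_rpow ha.le (by linarith)
    simpa [Real.zero_rpow hp0] using this
  rcases hab.eq_or_lt with hab | hab
  · have := one_le_sin_rpow_add_cos_rpow ha.le (by linarith)
    rw [hab, show b = Real.pi / 2 - a by linarith, Real.sin_pi_div_two_sub, Real.cos_pi_div_two,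
      Real.zero_rpow hp0, add_zero]
    exact this
  have l1 : IsLocalMin (fun z => Real.sin z ^ (2 * halfExp) + Real.sin b ^ (2 * halfExp)
      + Real.cos (z + b) ^ (2 * halfExp)) a := by
    filter_upwards [Ioo_mem_nhds ha (show a < Real.pi / 2 - b by linarith)] with z hz
    exact hmin' z b hz.1.le hb.le (by linarith [hz.2])
  have l2 : IsLocalMin (fun z => Real.sin z ^ (2 * halfExp) + Real.sin a ^ (2 * halfExp)
      + Real.cos (z + a) ^ (2 * halfExp)) b := by
    filter_upwards [Ioo_mem_nhds hb (show b < Real.pi / 2 - a by linarith)] with z hz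
    have := hmin' a z ha.le hz.1.le (by linarith [hz.2])
    rw [add_comm z a, add_comm b a]
    linarith
  have e1 := logSlope_eq_of_isLocalMin ha hb hab l1
  have e2 := logSlope_eq_of_isLocalMin hb ha (by linarith) l2
  rw [sub_right_comm] at e2
  have hw0 : 0 < Real.pi / 2 - a - b := by linarith
  rcases two_eq_of_logSlope_eq (sin_sq_mem_Ioo ha (by linarith))
    (sin_sq_mem_Ioo hw0 (by linarith)) (sin_sq_mem_Ioo hb (by linarith)) e1 e2.symm with h | h | h
  · have h := eq_of_sin_sq_eq ha (by linarith) hw0 (by linarith) h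
    have := one_le_iso_angle ha (by linarith)
    rw [show b = Real.pi / 2 - (a + a) by linarith, Real.sin_pi_div_two_sub,
      show a + (Real.pi / 2 - (a + a)) = Real.pi / 2 - a by ring, Real.cos_pi_div_two_sub]
    linarith
  · have h := eq_of_sin_sq_eq hw0 (by linarith) hb (by linarith) h
    have := one_le_iso_angle hb (by linarith)
    rw [show a = Real.pi / 2 - (b + b) by linarith, Real.sin_pi_div_two_sub,
      show Real.pi / 2 - (b + b) + b = Real.pi / 2 - b by ring, Real.cos_pi_div_two_sub]
    linarith
  · have h := eq_of_sin_sq_eq ha (by linarith) hb (by linarith) h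
    subst h
    exact one_le_iso_angle ha hab

/-- The three-vector case: the squared inner products of three lines in the plane. -/
theorem one_le_three_rpow {x u v : ℝ} (hx0 : 0 ≤ x) (hu0 : 0 ≤ u) (hv0 : 0 ≤ v) (hx1 : x ≤ 1)
    (hu1 : u ≤ 1) (hv1 : v ≤ 1) (h : (u + v + x - 1) ^ 2 = 4 * x * u * v) :
    1 ≤ u ^ halfExp + v ^ halfExp + x ^ halfExp := by
  rcases le_total 1 (u + v + x) with h1 | h1
  · have g1 := gain_nonneg hx0 hx1
    have g2 := gain_nonneg hu0 hu1
    have g3 := gain_nonneg hv0 hv1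
    simp only [gain] at g1 g2 g3
    linarith
  have hA := Real.sqrt_nonneg u
  have hB := Real.sqrt_nonneg v
  have hC := Real.sqrt_nonneg x
  have eA := Real.sq_sqrt hu0
  have eB := Real.sq_sqrt hv0
  have eC := Real.sq_sqrt hx0
  have A1 : √u ≤ 1 := Real.sqrt_le_one.2 hu1
  have B1 : √v ≤ 1 := Real.sqrt_le_one.2 hv1
  have h2 : 1 - (u + v + x) = 2 * (√u * √v * √x) := by
    have hn : 0 ≤ √u * √v * √x := by positivity
    refine (pow_left_inj₀ (by linarith) (by linarith) two_ne_zero).1 ?_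
    rw [mul_pow, mul_pow, mul_pow, eA, eB, eC]
    linear_combination h
  have h3 : √(1 - u) * √(1 - v) = √x + √u * √v := by
    rw [← Real.sqrt_mul (by linarith), Real.sqrt_eq_iff_mul_self_eq (by nlinarith) (by positivity)]
    linear_combination -eC - (√v ^ 2) * eA - u * eB + h2
  have hcos : Real.cos (Real.arcsin √u + Real.arcsin √v) = √x := by
    rw [Real.cos_add, Real.cos_arcsin, Real.cos_arcsin, Real.sin_arcsin (by linarith) A1,
      Real.sin_arcsin (by linarith) B1, eA, eB, h3]; ring
  have s0 := Real.arcsin_nonneg.2 hA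
  have t0 := Real.arcsin_nonneg.2 hB
  have hle : Real.arcsin √u + Real.arcsin √v ≤ Real.pi / 2 := by
    by_contra hc
    push Not at hc
    have := Real.cos_neg_of_pi_div_two_lt_of_lt hc
      (by linarith [Real.arcsin_le_pi_div_two √u, Real.arcsin_le_pi_div_two √v, Real.pi_pos])
    linarith
  have key := one_le_three_angles s0 t0 hle
  rw [hcos, Real.sin_arcsin (by linarith) A1, Real.sin_arcsin (by linarith) B1,
    ← sq_rpow_halfExp hA, ← sq_rpow_halfExp hB, ← sq_rpow_halfExp hC, eA, eB, eC] at key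
  exact key

/-! ### Configurations of lines in coordinates -/

/-- The squared inner product of the vectors `(α k, β k)` and `(α l, β l)`. -/
def sqInner {ι : Type*} (α β : ι → ℝ) (k l : ι) : ℝ := (α k * α l + β k * β l) ^ 2

/-- The potential at the critical exponent, summed over all ordered pairs from `s`, the diagonal
included. -/
noncomputable def potential {ι : Type*} (α β : ι → ℝ) (s : Finset ι) : ℝ :=
  ∑ k ∈ s, ∑ l ∈ s, sqInner α β k l ^ halfExp

/-- The squared length of the sum over `s` of the vectors with doubled angles. -/
def doubledNormSq {ι : Type*} (α β : ι → ℝ) (s : Finset ι) : ℝ :=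
  (∑ j ∈ s, (α j ^ 2 - β j ^ 2)) ^ 2 + (∑ j ∈ s, 2 * α j * β j) ^ 2

section

variable {ι : Type*} {α β : ι → ℝ}

theorem sqInner_comm (k l : ι) : sqInner α β k l = sqInner α β l k := by
  simp only [sqInner]; ring

theorem sqInner_nonneg (k l : ι) : 0 ≤ sqInner α β k l := sq_nonneg _

theorem sqInner_self (h : ∀ k, α k ^ 2 + β k ^ 2 = 1) (k : ι) : sqInner α β k k = 1 := by
  rw [sqInner, ← sq, ← sq, h, one_pow]

theorem sqInner_eq (h : ∀ k, α k ^ 2 + β k ^ 2 = 1) (k l : ι) : sqInner α β k l =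
    (1 + ((α k ^ 2 - β k ^ 2) * (α l ^ 2 - β l ^ 2) + 2 * α k * β k * (2 * α l * β l))) / 2 := by
  have e : (1 : ℝ) = (α k ^ 2 + β k ^ 2) * (α l ^ 2 + β l ^ 2) := by rw [h, h, one_mul]
  rw [sqInner]; linear_combination -(1 / 2) * e

theorem sqInner_le_one (h : ∀ k, α k ^ 2 + β k ^ 2 = 1) (k l : ι) : sqInner α β k l ≤ 1 := by
  have e : (1 : ℝ) = (α k ^ 2 + β k ^ 2) * (α l ^ 2 + β l ^ 2) := by rw [h, h, one_mul]
  rw [sqInner]; nlinarith [sq_nonneg (α k * β l - β k * α l)]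

/-- The Gram determinant of three vectors in the plane vanishes. -/
theorem sqInner_gram (h : ∀ k, α k ^ 2 + β k ^ 2 = 1) (k l j : ι) :
    (sqInner α β k j + sqInner α β l j + sqInner α β k l - 1) ^ 2
      = 4 * sqInner α β k l * sqInner α β k j * sqInner α β l j := by
  have G : (α k ^ 2 + β k ^ 2) * (α l ^ 2 + β l ^ 2) * (α j ^ 2 + β j ^ 2)
      + 2 * ((α k * α l + β k * β l) * (α k * α j + β k * β j) * (α l * α j + β l * β j))
      - (α k ^ 2 + β k ^ 2) * (α l * α j + β l * β j) ^ 2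
      - (α l ^ 2 + β l ^ 2) * (α k * α j + β k * β j) ^ 2
      - (α j ^ 2 + β j ^ 2) * (α k * α l + β k * β l) ^ 2 = 0 := by ring
  rw [h, h, h] at G
  have e : sqInner α β k j + sqInner α β l j + sqInner α β k l - 1 =
      2 * ((α k * α l + β k * β l) * (α k * α j + β k * β j) * (α l * α j + β l * β j)) := by
    simp only [sqInner]; linear_combination -G
  rw [e]; simp only [sqInner]; ring

theorem sqInner_eq_one_sub (h : ∀ k, α k ^ 2 + β k ^ 2 = 1) {k l : ι}
    (hkl : sqInner α β k l = 0) (j : ι) : sqInner α β l j = 1 - sqInner α β k j := by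
  have := sqInner_gram h k l j
  rw [hkl] at this
  have : sqInner α β k j + sqInner α β l j + 0 - 1 = 0 := by
    apply pow_eq_zero_iff two_ne_zero |>.1; rw [this]; ring
  linarith

theorem sum_sqInner (h : ∀ k, α k ^ 2 + β k ^ 2 = 1) (s : Finset ι) :
    ∑ k ∈ s, ∑ l ∈ s, sqInner α β k l = ((s.card : ℝ) ^ 2 + doubledNormSq α β s) / 2 := by
  simp_rw [sqInner_eq h, ← Finset.sum_div, Finset.sum_add_distrib, ← Finset.mul_sum,
    ← Finset.sum_mul]
  rw [doubledNormSq]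
  simp
  ring

theorem potential_eq (h : ∀ k, α k ^ 2 + β k ^ 2 = 1) (s : Finset ι) : potential α β s =
    ((s.card : ℝ) ^ 2 + doubledNormSq α β s) / 2 + ∑ k ∈ s, ∑ l ∈ s, gain (sqInner α β k l) := by
  rw [← sum_sqInner h, ← Finset.sum_add_distrib, potential]
  refine Finset.sum_congr rfl fun k _ => ?_
  rw [← Finset.sum_add_distrib]
  exact Finset.sum_congr rfl fun l _ => by simp [gain]

theorem doubledNormSq_nonneg (s : Finset ι) : 0 ≤ doubledNormSq α β s :=
  add_nonneg (sq_nonneg _) (sq_nonneg _)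

theorem le_potential (h : ∀ k, α k ^ 2 + β k ^ 2 = 1) (s : Finset ι) :
    ((s.card : ℝ) ^ 2 + doubledNormSq α β s) / 2 ≤ potential α β s := by
  rw [potential_eq h, le_add_iff_nonneg_right]
  exact Finset.sum_nonneg fun k _ => Finset.sum_nonneg fun l _ =>
    gain_nonneg (sqInner_nonneg k l) (sqInner_le_one h k l)

/-- Without nearly orthogonal pairs, the chord bound for `gain` suffices. -/
theorem lt_potential_of_forall_ge (h : ∀ k, α k ^ 2 + β k ^ 2 = 1) {s : Finset ι}
    (hs : 5 ≤ s.card) (hx : ∀ k ∈ s, ∀ l ∈ s, 1 / 16 ≤ sqInner α β k l) :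
    ((s.card : ℝ) ^ 2 + 1) / 2 < potential α β s := by
  have hg : gain (1 / 16) = 7 / 144 := by
    have := gain_quarter_pow 2; norm_num at this ⊢; exact this
  have h1 : ∑ k ∈ s, ∑ l ∈ s, (7 / 135) * (1 - sqInner α β k l)
      ≤ ∑ k ∈ s, ∑ l ∈ s, gain (sqInner α β k l) :=
    Finset.sum_le_sum fun k hk => Finset.sum_le_sum fun l hl =>
      le_gain_of_chord (by norm_num) (by norm_num) (by rw [hg]; norm_num) (hx k hk l hl)
        (sqInner_le_one h k l)
  simp_rw [← Finset.mul_sum, Finset.sum_sub_distrib] at h1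
  rw [sum_sqInner h] at h1
  simp only [Finset.sum_const, nsmul_eq_mul, mul_one] at h1
  have hd := doubledNormSq_nonneg (α := α) (β := β) s
  have hc : (5 : ℝ) ≤ s.card := by exact_mod_cast hs
  rw [potential_eq h]
  nlinarith

theorem potential_insert_insert [DecidableEq ι] (h : ∀ k, α k ^ 2 + β k ^ 2 = 1) {s : Finset ι}
    {k l : ι} (hkl : k ≠ l) (hk : k ∉ s) (hl : l ∉ s) :
    potential α β (insert k (insert l s)) = potential α β s
      + 2 * ∑ j ∈ s, (sqInner α β k j ^ halfExp + sqInner α β l j ^ halfExp)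
      + 2 + 2 * sqInner α β k l ^ halfExp := by
  have hk' : k ∉ insert l s := by simp [hkl, hk]
  have c : ∀ i, ∑ j ∈ s, sqInner α β j i ^ halfExp = ∑ j ∈ s, sqInner α β i j ^ halfExp :=
    fun i => Finset.sum_congr rfl fun j _ => by rw [sqInner_comm]
  simp only [potential, Finset.sum_insert hk', Finset.sum_insert hl, Finset.sum_add_distrib,
    sqInner_self h, Real.one_rpow]
  rw [sqInner_comm l k, c, c]
  ring

/-- The sum over `s` of the deviations `⟨k, j⟩² + ⟨l, j⟩² - 1` is an inner product of the sum of
doubled vectors with a vector of length `|⟨k, l⟩|`. -/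
theorem neg_sqrt_mul_le_sum (h : ∀ k, α k ^ 2 + β k ^ 2 = 1) (s : Finset ι) (k l : ι) :
    -(√(sqInner α β k l) * √(doubledNormSq α β s))
      ≤ ∑ j ∈ s, (sqInner α β k j + sqInner α β l j - 1) := by
  have e : ∑ j ∈ s, (sqInner α β k j + sqInner α β l j - 1) =
      ((α k ^ 2 - β k ^ 2) + (α l ^ 2 - β l ^ 2)) / 2 * ∑ j ∈ s, (α j ^ 2 - β j ^ 2)
      + (2 * α k * β k + 2 * α l * β l) / 2 * ∑ j ∈ s, 2 * α j * β j := by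
    rw [Finset.mul_sum, Finset.mul_sum, ← Finset.sum_add_distrib]
    refine Finset.sum_congr rfl fun j _ => ?_
    rw [sqInner_eq h, sqInner_eq h]; ring
  have e2 : (((α k ^ 2 - β k ^ 2) + (α l ^ 2 - β l ^ 2)) / 2) ^ 2
      + ((2 * α k * β k + 2 * α l * β l) / 2) ^ 2 = sqInner α β k l := by
    have hk : (α k ^ 2 + β k ^ 2) ^ 2 = 1 := by rw [h, one_pow]
    have hl : (α l ^ 2 + β l ^ 2) ^ 2 = 1 := by rw [h, one_pow]
    rw [sqInner_eq h]
    linear_combination (1 / 4) * hk + (1 / 4) * hl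
  rw [e, ← Real.sqrt_mul (sqInner_nonneg k l)]
  refine (abs_le.1 (Real.abs_le_sqrt ?_)).1
  rw [← e2, doubledNormSq]
  set A := ((α k ^ 2 - β k ^ 2) + (α l ^ 2 - β l ^ 2)) / 2
  set B := (2 * α k * β k + 2 * α l * β l) / 2
  set C := ∑ j ∈ s, (α j ^ 2 - β j ^ 2)
  set D := ∑ j ∈ s, 2 * α j * β j
  linarith [sq_nonneg (A * D - B * C)]

/-- Adding a pair that is very close to orthogonal: the shares `x ^ halfExp / n` by which the other
`n` lines may fall short of `1` sum up to what the pair itself contributes. -/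
theorem lt_potential_insert_of_small [DecidableEq ι] (h : ∀ k, α k ^ 2 + β k ^ 2 = 1)
    {s : Finset ι} {k l : ι} (hkl : k ≠ l) (hk : k ∉ s) (hl : l ∉ s) (hs : 3 ≤ s.card)
    (hT : ((s.card : ℝ) ^ 2 + 1) / 2 ≤ potential α β s) (hx : 0 < sqInner α β k l)
    (hsmall : √(sqInner α β k l) ≤ 1 / (3 * s.card))
    (hkj : ∀ j ∈ s, sqInner α β k l ≤ sqInner α β k j)
    (hlj : ∀ j ∈ s, sqInner α β k l ≤ sqInner α β l j) :
    (((s.card : ℝ) + 2) ^ 2 + 1) / 2 < potential α β (insert k (insert l s)) := by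
  have hn : (3 : ℝ) ≤ s.card := by exact_mod_cast hs
  have hne : s.Nonempty := Finset.card_pos.1 (by omega)
  rw [potential_insert_insert h hkl hk hl]
  have h1 : ∑ j ∈ s, (1 - sqInner α β k l ^ halfExp / s.card)
      < ∑ j ∈ s, (sqInner α β k j ^ halfExp + sqInner α β l j ^ halfExp) := by
    refine Finset.sum_lt_sum_of_nonempty hne fun j hj => ?_
    have := one_lt_rpow_add_rpow hn hx hsmall (hkj j hj) (hlj j hj) (sqInner_le_one h _ _)
      (sqInner_le_one h _ _) (sqInner_gram h k l j)
    linarith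
  rw [Finset.sum_const, nsmul_eq_mul, mul_sub, mul_div_cancel₀ _ (by linarith)] at h1
  linarith

/-- Adding a pair at moderate distance from orthogonal. The hypothesis `hgain` bounds the
contribution of each other line from below by an affine function of its deviation
`⟨k, j⟩² + ⟨l, j⟩² - 1`; by `neg_sqrt_mul_le_sum` the deviations can only be very negative in total
if the doubled vectors have a long sum, and then `le_potential` improves on `hT`. -/
theorem lt_potential_insert_of_chord [DecidableEq ι] (h : ∀ k, α k ^ 2 + β k ^ 2 = 1)
    {s : Finset ι} {k l : ι} (hkl : k ≠ l) (hk : k ∉ s) (hl : l ∉ s) {τ : ℝ} (hτ0 : 0 ≤ τ)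
    (hτ1 : τ ≤ 1)
    (hT : ((s.card : ℝ) ^ 2 + 1) / 2 ≤ potential α β s) (hx : 0 < sqInner α β k l)
    (hx4 : √(sqInner α β k l) ≤ 1 / 4)
    (hgain : ∀ j ∈ s, gain (sqInner α β k l)
        + τ * (sqInner α β k l - (sqInner α β k j + sqInner α β l j - 1))
      ≤ gain (sqInner α β k j) + gain (sqInner α β l j))
    (hnum : (1 - τ) * (1 + s.card * √(sqInner α β k l))
      < (s.card + 1) * √(sqInner α β k l) ^ (2 * halfExp - 1)) :
    (((s.card : ℝ) + 2) ^ 2 + 1) / 2 < potential α β (insert k (insert l s)) := by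
  rw [potential_insert_insert h hkl hk hl]
  have hT2 := le_potential h s
  have hD := neg_sqrt_mul_le_sum h s k l
  have hz := Real.sqrt_nonneg (doubledNormSq α β s)
  have hz2 := Real.sq_sqrt (doubledNormSq_nonneg (α := α) (β := β) s)
  have ha := Real.sqrt_pos.2 hx
  have hxa := Real.sq_sqrt hx.le
  have hxr := sqrt_rpow hx
  have h1 : ∑ j ∈ s, ((1 + gain (sqInner α β k l) + τ * sqInner α β k l)
        + (1 - τ) * (sqInner α β k j + sqInner α β l j - 1))
      ≤ ∑ j ∈ s, (sqInner α β k j ^ halfExp + sqInner α β l j ^ halfExp) := by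
    refine Finset.sum_le_sum fun j hj => ?_
    have := hgain j hj
    simp only [gain] at this ⊢
    linarith
  rw [Finset.sum_add_distrib, ← Finset.mul_sum, Finset.sum_const, nsmul_eq_mul] at h1
  have h2 := mul_lt_mul_of_pos_left hnum ha
  rw [show gain (sqInner α β k l) = sqInner α β k l ^ halfExp - sqInner α β k l from rfl] at h1
  have h3 := mul_le_mul_of_nonneg_left hD (sub_nonneg.2 hτ1)
  generalize sqInner α β k l = x at *
  generalize √x = a at *
  generalize √(doubledNormSq α β s) = z at *
  generalize doubledNormSq α β s = z2 at *
  generalize potential α β s = T at *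
  generalize ∑ j ∈ s, (sqInner α β k j + sqInner α β l j - 1) = D at *
  generalize ∑ j ∈ s, (sqInner α β k j ^ halfExp + sqInner α β l j ^ halfExp) = R at *
  generalize (s.card : ℝ) = n at *
  have h4 : (n + 1) * x ^ halfExp = a * ((n + 1) * a ^ (2 * halfExp - 1)) := by rw [← hxr]; ring
  -- the length `z` of the doubled sum costs at most what it adds to the lower bound for `T`
  have h5 : (1 - τ) * (a * z) ≤ (1 - τ) * a + (T - (n ^ 2 + 1) / 2) / 2 := by
    rcases le_total z 1 with h | h
    · have : (1 - τ) * (a * z) ≤ (1 - τ) * (a * 1) := by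
        have : 0 ≤ 1 - τ := by linarith
        gcongr
      linarith
    · have e1 : a * (z - 1) ≤ (z ^ 2 - 1) / 4 := by nlinarith
      have e2 : (1 - τ) * (a * (z - 1)) ≤ a * (z - 1) := by
        have := mul_nonneg ha.le (sub_nonneg.2 h)
        nlinarith
      linarith
  have h6 : n * (1 + (x ^ halfExp - x) + τ * x) = n + (n + 1) * x ^ halfExp - x ^ halfExp
    - (1 - τ) * n * x := by ring
  have h7 : (1 - τ) * n * x = a * ((1 - τ) * (1 + n * a)) - (1 - τ) * a := by rw [← hxa]; ring
  rw [h6, h4, h7] at h1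
  linarith

/-- Adding to at least three lines a pair that is closest to orthogonal in the resulting
configuration, but not orthogonal, gives a strict inequality. The threshold `1 / (3 n)` is where the
two numerical conditions `rpow_gt_of_small` and `rpow_gt_of_mid` coincide. -/
theorem lt_potential_insert_of_isMin [DecidableEq ι] (h : ∀ k, α k ^ 2 + β k ^ 2 = 1)
    {s : Finset ι} {k l : ι} (hkl : k ≠ l) (hk : k ∉ s) (hl : l ∉ s) (hs : 3 ≤ s.card)
    (hT : ((s.card : ℝ) ^ 2 + 1) / 2 ≤ potential α β s) (hx : 0 < sqInner α β k l)
    (hmin : ∀ i ∈ insert k (insert l s), ∀ j ∈ insert k (insert l s), i ≠ j →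
      sqInner α β k l ≤ sqInner α β i j) :
    (((s.card : ℝ) + 2) ^ 2 + 1) / 2 < potential α β (insert k (insert l s)) := by
  have hn : (3 : ℝ) ≤ s.card := by exact_mod_cast hs
  have hkj : ∀ j ∈ s, sqInner α β k l ≤ sqInner α β k j := fun j hj =>
    hmin k (by simp) j (by simp [hj]) (by rintro rfl; exact hk hj)
  have hlj : ∀ j ∈ s, sqInner α β k l ≤ sqInner α β l j := fun j hj =>
    hmin l (by simp) j (by simp [hj]) (by rintro rfl; exact hl hj)
  have hsq := Real.sq_sqrt hx.le
  have ha := Real.sqrt_pos.2 hx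
  have hadd : ∀ j, 1 - √(sqInner α β k l) ≤ sqInner α β k j + sqInner α β l j := fun j =>
    one_sub_sqrt_le_add hx.le (sqInner_nonneg _ _) (sqInner_nonneg _ _) (sqInner_gram h k l j)
  rcases le_total (√(sqInner α β k l)) (1 / (3 * s.card)) with h1 | h1
  · exact lt_potential_insert_of_small h hkl hk hl hs hT hx h1 hkj hlj
  rcases le_total (√(sqInner α β k l)) (1 / 8) with h2 | h2
  · refine lt_potential_insert_of_chord h hkl hk hl (τ := 0.18) (by norm_num) (by norm_num) hT hx
      (by linarith) (fun j hj => gain_add_gain_ge_of_le_sixtyFourth hx (by nlinarith) (hkj j hj) (hlj j hj)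
        (sqInner_le_one h _ _) (sqInner_le_one h _ _) (hadd j)) ?_
    have := rpow_gt_of_mid hn h1 h2
    linarith
  rcases le_total (√(sqInner α β k l)) (1 / 4) with h3 | h3
  · refine lt_potential_insert_of_chord h hkl hk hl (τ := 0.15) (by norm_num) (by norm_num) hT hx
      h3 (fun j hj => gain_add_gain_ge_of_le_sixteenth hx (by nlinarith) (hkj j hj) (hlj j hj)
        (sqInner_le_one h _ _) (sqInner_le_one h _ _) (hadd j)) ?_
    have := rpow_gt_of_large hn h2 h3
    linarith
  · have hc : (insert k (insert l s)).card = s.card + 2 := by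
      rw [Finset.card_insert_of_notMem (by simp [hkl, hk]), Finset.card_insert_of_notMem hl]
    have := lt_potential_of_forall_ge h (s := insert k (insert l s)) (by omega) ?_
    · rw [hc] at this; push_cast at this; exact this
    · intro i hi j hj
      rcases eq_or_ne i j with rfl | hij
      · rw [sqInner_self h]; norm_num
      · exact le_trans (by nlinarith) (hmin i hi j hj hij)

/-- Lines that are each parallel to one of two orthogonal lines are pairwise parallel or
orthogonal. -/
theorem sqInner_eq_zero_or_one (h : ∀ k, α k ^ 2 + β k ^ 2 = 1) {k i j : ι}
    (hi : sqInner α β k i = 0 ∨ sqInner α β k i = 1)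
    (hj : sqInner α β k j = 0 ∨ sqInner α β k j = 1) :
    sqInner α β i j = 0 ∨ sqInner α β i j = 1 := by
  have G := sqInner_gram h k i j
  rcases hi with hi | hi
  · have := sqInner_eq_one_sub h hi j
    rcases hj with hj | hj
    · right; linarith
    · left; linarith
  · rcases hj with hj | hj
    · have := sqInner_eq_one_sub h hj i
      rw [sqInner_comm j i] at this
      left; linarith
    · rw [hi, hj] at G
      right
      have : (sqInner α β i j - 1) ^ 2 = 0 := by linear_combination G
      have := pow_eq_zero_iff two_ne_zero |>.1 this
      linarith

/-- The minimal value of the potential at the critical exponent, and the equality case for at least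
five lines. -/
theorem potential_ge_and_eq (h : ∀ k, α k ^ 2 + β k ^ 2 = 1) (m : ℕ) :
    ∀ s : Finset ι, s.card = 2 * m + 1 → ((s.card : ℝ) ^ 2 + 1) / 2 ≤ potential α β s ∧
      (2 ≤ m → potential α β s ≤ ((s.card : ℝ) ^ 2 + 1) / 2 →
        ∀ i ∈ s, ∀ j ∈ s, sqInner α β i j = 0 ∨ sqInner α β i j = 1) := by
  classical
  induction m with
  | zero =>
    intro s hs
    obtain ⟨a, rfl⟩ := Finset.card_eq_one.1 hs
    refine ⟨?_, by omega⟩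
    simp [potential, sqInner_self h]
  | succ m ih =>
    intro t ht
    obtain ⟨⟨k, l⟩, hq, hmin⟩ := t.offDiag.exists_min_image (fun q => sqInner α β q.1 q.2) (by
      obtain ⟨a, ha, b, hb, hab⟩ := Finset.one_lt_card.1 (show 1 < t.card by omega)
      exact ⟨(a, b), Finset.mem_offDiag.2 ⟨ha, hb, hab⟩⟩)
    obtain ⟨hkt, hlt, hkl⟩ := Finset.mem_offDiag.1 hq
    simp only at hkt hlt hkl
    have hmin' : ∀ i ∈ t, ∀ j ∈ t, i ≠ j → sqInner α β k l ≤ sqInner α β i j := fun i hi j hj hij =>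
      hmin (i, j) (Finset.mem_offDiag.2 ⟨hi, hj, hij⟩)
    obtain ⟨s, hsdef⟩ : ∃ s, s = (t.erase k).erase l := ⟨_, rfl⟩
    have hl : l ∉ s := by simp [hsdef]
    have hk : k ∉ s := by simp [hsdef]
    have hts : t = insert k (insert l s) := by
      rw [hsdef, Finset.insert_erase (Finset.mem_erase.2 ⟨hkl.symm, hlt⟩), Finset.insert_erase hkt]
    have hc : t.card = s.card + 2 := by
      rw [hts, Finset.card_insert_of_notMem (by simp [hkl, hk]), Finset.card_insert_of_notMem hl]
    have hcR : (t.card : ℝ) = s.card + 2 := by rw [hc]; push_cast; rfl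
    obtain ⟨hT, -⟩ := ih s (by omega)
    have hP := potential_insert_insert h hkl hk hl
    rw [← hts] at hP
    rw [hcR]
    rcases (sqInner_nonneg k l).eq_or_lt with hx | hx
    · rw [← hx, Real.zero_rpow halfExp_pos.ne'] at hP
      have hterm : ∀ j ∈ s, 1 ≤ sqInner α β k j ^ halfExp + sqInner α β l j ^ halfExp := by
        intro j _
        rw [sqInner_eq_one_sub h hx.symm]
        exact one_le_rpow_add_rpow_one_sub (sqInner_nonneg _ _) (sqInner_le_one h _ _)
      have hsum := Finset.sum_le_sum hterm
      rw [Finset.sum_const, nsmul_eq_mul, mul_one] at hsum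
      refine ⟨by linarith, fun _ hle => ?_⟩
      have heq : ∀ j ∈ s, (1 : ℝ) = sqInner α β k j ^ halfExp + sqInner α β l j ^ halfExp :=
        (Finset.sum_eq_sum_iff_of_le hterm).1 (by
          rw [Finset.sum_const, nsmul_eq_mul, mul_one]; linarith)
      have hk01 : ∀ j ∈ t, sqInner α β k j = 0 ∨ sqInner α β k j = 1 := by
        intro j hj
        rw [hts, Finset.mem_insert, Finset.mem_insert] at hj
        rcases hj with rfl | rfl | hj
        · exact Or.inr (sqInner_self h _)
        · exact Or.inl hx.symm
        · have := heq j hj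
          rw [sqInner_eq_one_sub h hx.symm] at this
          exact eq_zero_or_one_of_rpow (sqInner_nonneg _ _) (sqInner_le_one h _ _) this.ge
      exact fun i hi j hj => sqInner_eq_zero_or_one h (hk01 i hi) (hk01 j hj)
    · rcases Nat.eq_zero_or_pos m with rfl | hm
      · refine ⟨?_, by omega⟩
        obtain ⟨j, rfl⟩ := Finset.card_eq_one.1 (show s.card = 1 by omega)
        have := one_le_three_rpow (sqInner_nonneg k l) (sqInner_nonneg k j) (sqInner_nonneg l j)
          (sqInner_le_one h _ _) (sqInner_le_one h _ _) (sqInner_le_one h _ _)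
          (sqInner_gram h k l j)
        rw [Finset.sum_singleton] at hP
        rw [Finset.card_singleton] at hT ⊢
        norm_num at hT ⊢
        linarith
      · have := lt_potential_insert_of_isMin h hkl hk hl (by omega) hT hx (by rwa [← hts])
        rw [← hts] at this
        exact ⟨this.le, fun _ hle => absurd this (not_lt.2 hle)⟩

end

/-! ### Frame potentials and equivalence of configurations -/

section

variable {N : ℕ}

/-- The first coordinate of the vectors of a planar configuration. -/
def coordFst (X : UnitConfig N 2) (k : Fin N) : ℝ := (X k : EuclideanSpace ℝ (Fin 2)) 0

/-- The second coordinate of the vectors of a planar configuration. -/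
def coordSnd (X : UnitConfig N 2) (k : Fin N) : ℝ := (X k : EuclideanSpace ℝ (Fin 2)) 1

theorem inner_eq_coord (X : UnitConfig N 2) (k l : Fin N) :
    inner ℝ (X k : EuclideanSpace ℝ (Fin 2)) (X l : EuclideanSpace ℝ (Fin 2))
      = coordFst X k * coordFst X l + coordSnd X k * coordSnd X l := by
  simp only [PiLp.inner_apply, Fin.sum_univ_two, coordFst, coordSnd]
  simp [mul_comm]

theorem coord_sq_add_sq (X : UnitConfig N 2) (k : Fin N) :
    coordFst X k ^ 2 + coordSnd X k ^ 2 = 1 := by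
  have h : ‖(X k : EuclideanSpace ℝ (Fin 2))‖ = 1 := mem_sphere_zero_iff_norm.1 (X k).2
  rw [sq, sq, ← inner_eq_coord, real_inner_self_eq_norm_sq, h, one_pow]

theorem sq_inner (X : UnitConfig N 2) (k l : Fin N) :
    |inner ℝ (X k : EuclideanSpace ℝ (Fin 2)) (X l : EuclideanSpace ℝ (Fin 2))| ^ 2
      = sqInner (coordFst X) (coordSnd X) k l := by
  rw [inner_eq_coord, sq_abs, sqInner]

theorem abs_inner_le_one (X : UnitConfig N 2) (k l : Fin N) :
    |inner ℝ (X k : EuclideanSpace ℝ (Fin 2)) (X l : EuclideanSpace ℝ (Fin 2))| ≤ 1 := by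
  rw [← sq_le_one_iff₀ (abs_nonneg _), sq_inner]
  exact sqInner_le_one (coord_sq_add_sq X) k l

theorem sum_abs_inner_rpow {d : ℕ} (p : ℝ) (X : UnitConfig N d) :
    ∑ k, ∑ l, |inner ℝ (X k : EuclideanSpace ℝ (Fin d)) (X l : EuclideanSpace ℝ (Fin d))| ^ p
      = framePotential p X + N := by
  have hself : ∀ k, |inner ℝ (X k : EuclideanSpace ℝ (Fin d)) (X k : EuclideanSpace ℝ (Fin d))| ^ p
      = 1 := fun k => by
    have h : ‖(X k : EuclideanSpace ℝ (Fin d))‖ = 1 := mem_sphere_zero_iff_norm.1 (X k).2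
    rw [real_inner_self_eq_norm_sq, h, one_pow, abs_one, Real.one_rpow]
  have e : ∀ k, ∑ l, |inner ℝ (X k : EuclideanSpace ℝ (Fin d))
        (X l : EuclideanSpace ℝ (Fin d))| ^ p
      = ∑ l ∈ Finset.univ.erase k, |inner ℝ (X k : EuclideanSpace ℝ (Fin d))
        (X l : EuclideanSpace ℝ (Fin d))| ^ p + 1 := fun k => by
    rw [← Finset.sum_erase_add _ _ (Finset.mem_univ k), hself]
  simp_rw [e, Finset.sum_add_distrib]
  simp [framePotential]

theorem two_mul_halfExp : 2 * halfExp = Real.log 3 / Real.log 2 := by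
  rw [eq_div_iff (Real.log_pos (by norm_num)).ne', ← log_three_eq]

theorem potential_univ_eq (X : UnitConfig N 2) : potential (coordFst X) (coordSnd X) Finset.univ
    = framePotential (Real.log 3 / Real.log 2) X + N := by
  rw [← sum_abs_inner_rpow, potential, ← two_mul_halfExp]
  refine Finset.sum_congr rfl fun k _ => Finset.sum_congr rfl fun l _ => ?_
  rw [← sq_rpow_halfExp (abs_nonneg _), sq_inner]

theorem rpow_le_rpow_of_le_one {p q t : ℝ} (hp : 0 < p) (hpq : p ≤ q) (h0 : 0 ≤ t) (h1 : t ≤ 1) :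
    t ^ q ≤ t ^ p := by
  rcases h0.eq_or_lt with rfl | h0
  · rw [Real.zero_rpow hp.ne', Real.zero_rpow (hp.trans_le hpq).ne']
  · exact Real.rpow_le_rpow_of_exponent_ge h0 h1 hpq

theorem framePotential_anti {p q : ℝ} (hp : 0 < p) (hpq : p ≤ q) (X : UnitConfig N 2) :
    framePotential q X ≤ framePotential p X :=
  Finset.sum_le_sum fun k _ => Finset.sum_le_sum fun l _ =>
    rpow_le_rpow_of_le_one hp hpq (abs_nonneg _) (abs_inner_le_one X k l)

/-- Strict monotonicity in the exponent, unless all lines are pairwise parallel or orthogonal. -/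
theorem sqInner_eq_of_framePotential_le {p q : ℝ} (hp : 0 < p) (hpq : p < q) (X : UnitConfig N 2)
    (h : framePotential p X ≤ framePotential q X) (i j : Fin N) :
    sqInner (coordFst X) (coordSnd X) i j = 0 ∨ sqInner (coordFst X) (coordSnd X) i j = 1 := by
  have hle : ∀ k l : Fin N, |inner ℝ (X k : EuclideanSpace ℝ (Fin 2))
        (X l : EuclideanSpace ℝ (Fin 2))| ^ q
      ≤ |inner ℝ (X k : EuclideanSpace ℝ (Fin 2)) (X l : EuclideanSpace ℝ (Fin 2))| ^ p :=
    fun k l => rpow_le_rpow_of_le_one hp hpq.le (abs_nonneg _) (abs_inner_le_one X k l)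
  have hsum := le_antisymm (Finset.sum_le_sum fun k (_ : k ∈ Finset.univ) =>
      Finset.sum_le_sum fun l (_ : l ∈ Finset.univ) => hle k l)
    (by rw [sum_abs_inner_rpow, sum_abs_inner_rpow]; linarith)
  have h1 := (Finset.sum_eq_sum_iff_of_le fun k _ => Finset.sum_le_sum fun l _ => hle k l).1 hsum
    i (Finset.mem_univ i)
  have h2 := (Finset.sum_eq_sum_iff_of_le fun l _ => hle i l).1 h1 j (Finset.mem_univ j)
  rw [← sq_inner]
  have t1 := abs_inner_le_one X i j
  rcases (abs_nonneg (inner ℝ (X i : EuclideanSpace ℝ (Fin 2))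
    (X j : EuclideanSpace ℝ (Fin 2)))).eq_or_lt with h0 | h0
  · left; rw [← h0]; norm_num
  · right
    rcases t1.eq_or_lt with h3 | h3
    · rw [h3, one_pow]
    · exact absurd h2 (Real.rpow_lt_rpow_of_exponent_gt h0 h3 hpq).ne

theorem le_framePotential {p : ℝ} (hp : 0 < p) (hp_le : p ≤ Real.log 3 / Real.log 2)
    (hN : Odd N) (X : UnitConfig N 2) : ((N : ℝ) - 1) ^ 2 / 2 ≤ framePotential p X := by
  obtain ⟨m, rfl⟩ := hN
  have h := (potential_ge_and_eq (coord_sq_add_sq X) m Finset.univ (by simp)).1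
  rw [potential_univ_eq, Finset.card_univ, Fintype.card_fin] at h
  have := framePotential_anti hp hp_le X
  linarith

theorem sqInner_eq_of_framePotential_le_min {p : ℝ} (hp : 0 < p)
    (hp_le : p ≤ Real.log 3 / Real.log 2) (hN3 : 3 ≤ N) (hN : Odd N)
    (hex : ¬ (N = 3 ∧ p = Real.log 3 / Real.log 2)) {X : UnitConfig N 2}
    (h : framePotential p X ≤ ((N : ℝ) - 1) ^ 2 / 2) (i j : Fin N) :
    sqInner (coordFst X) (coordSnd X) i j = 0 ∨ sqInner (coordFst X) (coordSnd X) i j = 1 := by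
  rcases hp_le.eq_or_lt with hpe | hpl
  · have hN3' : N ≠ 3 := fun h3 => hex ⟨h3, hpe⟩
    obtain ⟨m, rfl⟩ := hN
    refine (potential_ge_and_eq (coord_sq_add_sq X) m Finset.univ (by simp)).2 (by omega) ?_
      i (Finset.mem_univ i) j (Finset.mem_univ j)
    rw [potential_univ_eq, Finset.card_univ, Fintype.card_fin, ← hpe]
    linarith
  · exact sqInner_eq_of_framePotential_le hp hpl X
      (h.trans (le_framePotential (hp.trans hpl) le_rfl hN X)) i j

theorem sum_sum_ite_iff {ι : Type*} [Fintype ι] (P : ι → Prop) [DecidablePred P] :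
    ∑ k, ∑ l, (if (P k ↔ P l) then (1 : ℝ) else 0)
      = ((Finset.univ.filter P).card : ℝ) ^ 2
        + ((Finset.univ.filter fun k => ¬ P k).card : ℝ) ^ 2 := by
  have e : ∀ k, ∑ l, (if (P k ↔ P l) then (1 : ℝ) else 0) = if P k then
      ((Finset.univ.filter P).card : ℝ) else ((Finset.univ.filter fun k => ¬ P k).card : ℝ) := by
    intro k
    rw [Finset.sum_boole]
    by_cases hk : P k <;> simp [hk]
  simp_rw [e]
  rw [Finset.sum_ite, Finset.sum_const, Finset.sum_const, nsmul_eq_mul, nsmul_eq_mul, sq, sq]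

theorem card_filter_lt (h : ℕ) (hh : h ≤ N) :
    (Finset.univ.filter fun k : Fin N => (k : ℕ) < h).card = h := by
  rw [Fin.card_filter_val_lt, min_eq_right hh]

theorem framePotential_perpConfig {p : ℝ} (hp : 0 < p) (hN : Odd N) :
    framePotential p (perpConfig N) = ((N : ℝ) - 1) ^ 2 / 2 := by
  have hterm : ∀ k l : Fin N, |inner ℝ (perpConfig N k : EuclideanSpace ℝ (Fin 2))
      (perpConfig N l : EuclideanSpace ℝ (Fin 2))| ^ p
      = if ((k : ℕ) < (N + 1) / 2 ↔ (l : ℕ) < (N + 1) / 2) then (1 : ℝ) else 0 := by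
    intro k l
    by_cases hk : (k : ℕ) < (N + 1) / 2 <;> by_cases hl : (l : ℕ) < (N + 1) / 2 <;>
      simp [perpConfig, stdVec, EuclideanSpace.inner_single_left, hk, hl, hp.ne']
  have h := sum_abs_inner_rpow p (perpConfig N)
  simp_rw [hterm] at h
  rw [sum_sum_ite_iff] at h
  obtain ⟨m, rfl⟩ := hN
  have c1 := card_filter_lt (N := 2 * m + 1) ((2 * m + 1 + 1) / 2) (by omega)
  have c2 := Finset.card_filter_add_card_filter_not (s := (Finset.univ : Finset (Fin (2 * m + 1))))
    (fun k => (k : ℕ) < (2 * m + 1 + 1) / 2)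
  rw [c1, Finset.card_univ, Fintype.card_fin] at c2
  have c3 : (Finset.univ.filter fun k : Fin (2 * m + 1) =>
    ¬ (k : ℕ) < (2 * m + 1 + 1) / 2).card = m := by omega
  rw [c1, c3, show (2 * m + 1 + 1) / 2 = m + 1 by omega] at h
  push_cast at h ⊢
  linarith

theorem framePotential_eq_of_configEquiv {d : ℕ} (p : ℝ) {X X' : UnitConfig N d}
    (h : ConfigEquiv X X') : framePotential p X' = framePotential p X := by
  obtain ⟨U, σ, s, hs, hX⟩ := h
  have habs : ∀ k, |s k| = 1 := fun k => by rcases hs k with h | h <;> rw [h] <;> simp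
  have e : ∀ k l, |inner ℝ (X' k : EuclideanSpace ℝ (Fin d)) (X' l : EuclideanSpace ℝ (Fin d))| ^ p
      = |inner ℝ (X (σ k) : EuclideanSpace ℝ (Fin d)) (X (σ l) : EuclideanSpace ℝ (Fin d))| ^ p := by
    intro k l
    rw [hX k, hX l, real_inner_smul_left, real_inner_smul_right, U.inner_map_map, abs_mul, abs_mul,
      habs, habs, one_mul, one_mul]
  have h1 := sum_abs_inner_rpow p X'
  have h2 := sum_abs_inner_rpow p X
  simp_rw [e] at h1
  rw [Equiv.sum_comp σ (fun k => ∑ l, |inner ℝ (X k : EuclideanSpace ℝ (Fin d))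
    (X (σ l) : EuclideanSpace ℝ (Fin d))| ^ p)] at h1
  have h3 : ∀ k, ∑ l, |inner ℝ (X k : EuclideanSpace ℝ (Fin d))
      (X (σ l) : EuclideanSpace ℝ (Fin d))| ^ p = ∑ l, |inner ℝ (X k : EuclideanSpace ℝ (Fin d))
      (X l : EuclideanSpace ℝ (Fin d))| ^ p := fun k =>
    Equiv.sum_comp σ (fun l => |inner ℝ (X k : EuclideanSpace ℝ (Fin d))
      (X l : EuclideanSpace ℝ (Fin d))| ^ p)
  simp_rw [h3] at h1
  linarith

/-- The rotation of the plane that maps `e₁` to `(c, s)`. -/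
theorem exists_rotation {c s : ℝ} (h : c ^ 2 + s ^ 2 = 1) :
    ∃ U : EuclideanSpace ℝ (Fin 2) ≃ₗᵢ[ℝ] EuclideanSpace ℝ (Fin 2),
      ∀ x, U x = !₂[c * x 0 - s * x 1, s * x 0 + c * x 1] := by
  let L : EuclideanSpace ℝ (Fin 2) →ₗ[ℝ] EuclideanSpace ℝ (Fin 2) :=
    { toFun := fun x => !₂[c * x 0 - s * x 1, s * x 0 + c * x 1]
      map_add' := fun x y => by ext i; fin_cases i <;> simp <;> ring
      map_smul' := fun a x => by ext i; fin_cases i <;> simp <;> ring }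
  let I : EuclideanSpace ℝ (Fin 2) →ₗᵢ[ℝ] EuclideanSpace ℝ (Fin 2) :=
    { toLinearMap := L
      norm_map' := fun x => by
        rw [EuclideanSpace.norm_eq, EuclideanSpace.norm_eq]
        congr 1
        simp only [Fin.sum_univ_two, Real.norm_eq_abs, sq_abs]
        change (c * x 0 - s * x 1) ^ 2 + (s * x 0 + c * x 1) ^ 2 = x 0 ^ 2 + x 1 ^ 2
        linear_combination (x 0 ^ 2 + x 1 ^ 2) * h }
  exact ⟨I.toLinearIsometryEquiv rfl, fun x => rfl⟩

/-- If all lines are pairwise parallel or orthogonal and the potential is minimal, then one of the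
two directions occurs exactly `m + 1` times. -/
theorem exists_card_filter_eq {m : ℕ} {α β : Fin (2 * m + 1) → ℝ}
    (h : ∀ k, α k ^ 2 + β k ^ 2 = 1)
    (h01 : ∀ i j, sqInner α β i j = 0 ∨ sqInner α β i j = 1)
    (hP : potential α β Finset.univ ≤ (((2 * m + 1 : ℕ) : ℝ) ^ 2 + 1) / 2) :
    ∃ k, (Finset.univ.filter fun j => sqInner α β k j = 1).card = m + 1 := by
  classical
  have hterm : ∀ k i j : Fin (2 * m + 1), sqInner α β i j ^ halfExp
      = if (sqInner α β k i = 1 ↔ sqInner α β k j = 1) then (1 : ℝ) else 0 := by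
    intro k i j
    have G := sqInner_gram h k i j
    have hz := Real.zero_rpow halfExp_pos.ne'
    rcases h01 k i with h1 | h1 <;> rcases h01 k j with h2 | h2 <;> rcases h01 i j with h3 | h3 <;>
      rw [h1, h2, h3] at G ⊢ <;> first | (norm_num [hz]; done) | norm_num at G
  have hcard : ∀ k, ((Finset.univ.filter fun j => sqInner α β k j = 1).card = m ∨
      (Finset.univ.filter fun j => sqInner α β k j = 1).card = m + 1) := by
    intro k
    have hP' := hP
    simp_rw [potential, hterm k] at hP'
    rw [sum_sum_ite_iff] at hP'
    have c2 := Finset.card_filter_add_card_filter_not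
      (s := (Finset.univ : Finset (Fin (2 * m + 1)))) (fun j => sqInner α β k j = 1)
    rw [Finset.card_univ, Fintype.card_fin] at c2
    generalize (Finset.univ.filter fun j => sqInner α β k j = 1).card = a at *
    generalize (Finset.univ.filter fun j => ¬ sqInner α β k j = 1).card = b at *
    have h3 : 2 * (a ^ 2 + b ^ 2) ≤ (2 * m + 1) ^ 2 + 1 := by
      have : (2 : ℝ) * ((a : ℝ) ^ 2 + (b : ℝ) ^ 2) ≤ ((2 * m + 1 : ℕ) : ℝ) ^ 2 + 1 := by linarith
      exact_mod_cast this
    rcases lt_or_ge a m with h4 | h4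
    · nlinarith
    · rcases lt_or_ge (m + 1) a with h5 | h5
      · nlinarith
      · omega
  by_contra hc
  push Not at hc
  have hm : ∀ k, (Finset.univ.filter fun j => sqInner α β k j = 1).card = m := fun k =>
    (hcard k).resolve_right (hc k)
  have c2 := Finset.card_filter_add_card_filter_not
    (s := (Finset.univ : Finset (Fin (2 * m + 1)))) (fun j => sqInner α β 0 j = 1)
  rw [hm 0, Finset.card_univ, Fintype.card_fin] at c2
  have hne : (Finset.univ.filter fun j => ¬ sqInner α β 0 j = 1).Nonempty :=
    Finset.card_pos.1 (by omega)
  obtain ⟨k, hk⟩ := hne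
  have hk1 := (Finset.mem_filter.1 hk).2
  have hk0 : sqInner α β 0 k = 0 := (h01 0 k).resolve_right hk1
  have hset : (Finset.univ.filter fun j => ¬ sqInner α β 0 j = 1)
      = Finset.univ.filter fun j => sqInner α β k j = 1 := by
    ext j
    simp only [Finset.mem_filter, Finset.mem_univ, true_and]
    have e := sqInner_eq_one_sub h hk0 j
    rcases h01 0 j with h1 | h1 <;> rw [e, h1] <;> norm_num
  have := hm k
  rw [← hset] at this
  omega

theorem configEquiv_perpConfig_of_sqInner {m : ℕ} {X : UnitConfig (2 * m + 1) 2}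
    (h01 : ∀ i j, sqInner (coordFst X) (coordSnd X) i j = 0 ∨
      sqInner (coordFst X) (coordSnd X) i j = 1)
    (hP : potential (coordFst X) (coordSnd X) Finset.univ
      ≤ (((2 * m + 1 : ℕ) : ℝ) ^ 2 + 1) / 2) : ConfigEquiv (perpConfig (2 * m + 1)) X := by
  classical
  have h := coord_sq_add_sq X
  obtain ⟨k, hk⟩ := exists_card_filter_eq h h01 hP
  obtain ⟨U, hU⟩ := exists_rotation (h k)
  have hcard : Fintype.card {j // sqInner (coordFst X) (coordSnd X) k j = 1}
      = Fintype.card {j : Fin (2 * m + 1) // (j : ℕ) < (2 * m + 1 + 1) / 2} := by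
    rw [Fintype.card_subtype, Fintype.card_subtype, hk, card_filter_lt _ (by omega)]
    omega
  let e := Fintype.equivOfCardEq hcard
  have hid : ∀ j, (coordFst X k * coordSnd X j - coordSnd X k * coordFst X j) ^ 2
      + sqInner (coordFst X) (coordSnd X) k j = 1 := fun j => by
    rw [sqInner]; linear_combination h k * (coordFst X j ^ 2 + coordSnd X j ^ 2) + h j
  -- along the direction of `X k` the sign is the inner product, otherwise the determinant
  refine ⟨U, e.extendSubtype, fun j => if sqInner (coordFst X) (coordSnd X) k j = 1 then
    coordFst X k * coordFst X j + coordSnd X k * coordSnd X j else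
    coordFst X k * coordSnd X j - coordSnd X k * coordFst X j, fun j => ?_, fun j => ?_⟩
  · have hid := hid j
    beta_reduce
    split_ifs with h1
    · exact sq_eq_one_iff.1 h1
    · rw [(h01 k j).resolve_right h1, add_zero] at hid
      exact sq_eq_one_iff.1 hid
  · have hid := hid j
    beta_reduce
    have hkk := h k
    by_cases h1 : sqInner (coordFst X) (coordSnd X) k j = 1
    · have hlt := e.extendSubtype_mem j h1
      have hz : coordFst X k * coordSnd X j - coordSnd X k * coordFst X j = 0 :=
        pow_eq_zero_iff two_ne_zero |>.1 (by linarith)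
      rw [hU, if_pos h1, perpConfig, if_pos hlt]
      ext i
      fin_cases i
      · simp [stdVec]
        change coordFst X j = _
        linear_combination -(coordFst X j) * hkk - coordSnd X k * hz
      · simp [stdVec]
        change coordSnd X j = _
        linear_combination -(coordSnd X j) * hkk + coordFst X k * hz
    · have hlt := e.extendSubtype_not_mem j h1
      have h0 := (h01 k j).resolve_right h1
      have hz : coordFst X k * coordFst X j + coordSnd X k * coordSnd X j = 0 :=
        pow_eq_zero_iff two_ne_zero |>.1 h0
      rw [hU, if_neg h1, perpConfig, if_neg hlt]
      ext i
      fin_cases i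
      · simp [stdVec]
        change coordFst X j = _
        linear_combination -(coordFst X j) * hkk + coordFst X k * hz
      · simp [stdVec]
        change coordSnd X j = _
        linear_combination -(coordSnd X j) * hkk + coordSnd X k * hz

end

theorem theorem1 (p : ℝ) (hp_pos : 0 < p) (hp_le : p ≤ Real.log 3 / Real.log 2)
    (N : ℕ) (hN : 3 ≤ N) (hN_odd : Odd N) :
    IsLeast (Set.range (fun X : UnitConfig N 2 => framePotential p X)) (((N : ℝ) - 1) ^ 2 / 2) ∧
    (∀ X : UnitConfig N 2, ConfigEquiv (perpConfig N) X → IsFrameMinimizer p X) ∧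
    (¬ (N = 3 ∧ p = Real.log 3 / Real.log 2) →
      ∀ X : UnitConfig N 2, IsFrameMinimizer p X → ConfigEquiv (perpConfig N) X) := by
  have hlow := le_framePotential hp_pos hp_le hN_odd
  have hperp := framePotential_perpConfig hp_pos hN_odd
  refine ⟨⟨⟨perpConfig N, hperp⟩, ?_⟩, fun X hX Y => ?_, fun hex X hX => ?_⟩
  · rintro _ ⟨X, rfl⟩
    exact hlow X
  · rw [framePotential_eq_of_configEquiv p hX, hperp]
    exact hlow Y
  · have hle : framePotential p X ≤ ((N : ℝ) - 1) ^ 2 / 2 := hperp ▸ hX (perpConfig N)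
    have h01 := sqInner_eq_of_framePotential_le_min hp_pos hp_le hN hN_odd hex hle
    have hanti := framePotential_anti hp_pos hp_le X
    obtain ⟨m, rfl⟩ := hN_odd
    refine configEquiv_perpConfig_of_sqInner h01 ?_
    rw [potential_univ_eq]
    linarith
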